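/- Let $n\ge 1$, let $\mathcal E$ be a complex Hilbert space and let $\mathcal H$ be an infinite dimensional complex Hilbert space. Put $$[B(\mathcal H)^n]_1=\Big\{X\in B(\mathcal H)^n:\ \Big\|\sum_{i=1}^n X_iX_i^*\Big\|^{1/2}<1\Big\},\qquad [B(\mathcal H)^n]_1^-=\Big\{X\in B(\mathcal H)^n:\ \Big\|\sum_{i=1}^n X_iX_i^*\Big\|^{1/2}\le 1\Big\}.$$ Notation. Let $\mathbb F_n^+$ be the free monoid on $g_1,\dots,g_n$, with unit $g_0$, and for $\alpha=g_{i_1}\cdots g_{i_k}$ put $|\alpha|=k$ and $X_\alpha=X_{i_1}\cdots X_{i_k}$ (with $X_{g_0}=I$). Let $F^2(H_n)$ be the full Fock space, with orthonormal basis $(e_\alpha)_{\alpha\in\mathbb F_n^+}$ and $1:=e_{g_0}$, and let $S_i,R_i$ be the left and right creation operators, $S_ie_\alpha=e_{g_i\alpha}$, $R_ie_\alpha=e_{\alpha g_i}$. Let $\mathcal A_n$ be the norm closed algebra generated by $S_1,\dots,S_n$ and the identity, and let $\mathcal A_n(\mathcal E)=B(\mathcal E)\otimes_{min}\mathcal A_n$,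 i.e. the norm closure in $B(\mathcal E\otimes F^2(H_n))$ of the span of the operators $Y\otimes Z$ with $Y\in B(\mathcal E)$, $Z\in\mathcal A_n$. For any Hilbert space $\mathcal K$, a map $F:[B(\mathcal K)^n]_1\to B(\mathcal E)\otimes_{min}B(\mathcal K)$ is free holomorphic with coefficients $A_{(\alpha)}\in B(\mathcal E)$ if $\limsup_{k\to\infty}\big\|\sum_{|\alpha|=k}A_{(\alpha)}^*A_{(\alpha)}\big\|^{1/2k}\le 1$ and $F(X)=\sum_{k=0}^\infty\sum_{|\alpha|=k}A_{(\alpha)}\otimes X_\alpha$ in norm for every $X\in[B(\mathcal K)^n]_1$. A map $u$ is free pluriharmonic if $u=\mathrm{Re}\,F_1+i\,\mathrm{Re}\,F_2$ with $F_1,F_2$ free holomorphic. For such a $u$ on $[B(\mathcal H)^n]_1$ and $0\le r<1$, $u(rS_1,\dots,rS_n)$ denotes the value at $(rS_1,\dots,rS_n)$ of the free pluriharmonic function on $[B(F^2(H_n))^n]_1$ given by the same coefficients. For $X\in[B(\mathcal H)^n]_1$ and $f\in B(\mathcal E\otimes F^2(H_n))$ the Poisson transform is $$\mathbf P_X[f]=(I_{\mathcal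 E}\otimes K_X^*)(f\otimes I_{\mathcal H})(I_{\mathcal E}\otimes K_X),$$ where $K_X:\mathcal H\to F^2(H_n)\otimes\mathcal H$ is given by $$K_Xh=\Big(I\otimes\big(I-\sum_i X_iX_i^*\big)^{1/2}\Big)\Big(I-\sum_i R_i\otimes X_i^*\Big)^{-1}(1\otimes h).$$ Theorem. Let $u:[B(\mathcal H)^n]_1\to B(\mathcal E)\otimes_{min}B(\mathcal H)$. The following statements are equivalent: (i) $u$ is free pluriharmonic and has an extension to $[B(\mathcal H)^n]_1^-$, with values in $B(\mathcal E)\otimes_{min}B(\mathcal H)$, that is continuous in the operator norm topology; (ii) there is $f\in\overline{\mathcal A_n(\mathcal E)^*+\mathcal A_n(\mathcal E)}^{\|\cdot\|}$ such that $u(X)=\mathbf P_X[f]$ for all $X\in[B(\mathcal H)^n]_1$; (iii) $u$ is free pluriharmonic and $u(rS_1,\dots,rS_n)$ converges in the operator norm as $r\to1$, $0\le r<1$. In this case every $f$ as in (ii) satisfies $f=\lim_{r\to1}u(rS_1,\dots,rS_n)$ in the operator norm; in particular it is unique. Moreover, the set $Har^c(B(\mathcal H)^n_1)$ of all $u$ satisfying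 (i) is a linear space, and the map $\Phi:u\mapsto f$ is a linear bijection of $Har^c(B(\mathcal H)^n_1)$ onto $\overline{\mathcal A_n(\mathcal E)^*+\mathcal A_n(\mathcal E)}^{\|\cdot\|}$ which is completely isometric: for every $m$ and every $m\times m$ matrix $[u_{ij}]$ over $Har^c(B(\mathcal H)^n_1)$, $$\sup_{X\in[B(\mathcal H)^n]_1}\big\|[u_{ij}(X)]\big\|=\big\|[\Phi(u_{ij})]\big\|,$$ where an $m\times m$ matrix of operators on a Hilbert space $\mathcal K$ is normed as an operator on $\mathcal K^{(m)}$, the direct sum of $m$ copies of $\mathcal K$. -/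

import Mathlib

open scoped TensorProduct Topology

noncomputable section

namespace FreePluri

/-! ### Hilbert space tensor products and tensor products of operators -/

/-- The Hilbert space tensor product: the completion of the algebraic tensor product for the inner
product with `⟪x ⊗ y, x' ⊗ y'⟫ = ⟪x, x'⟫ ⟪y, y'⟫`. -/
abbrev HilbertTensor (E F : Type*) [NormedAddCommGroup E] [InnerProductSpace ℂ E]
    [NormedAddCommGroup F] [InnerProductSpace ℂ F] : Type _ :=
  UniformSpace.Completion (E ⊗[ℂ] F)

section Tensor

variable {E F G E' F' : Type*}
  [NormedAddCommGroup E] [InnerProductSpace ℂ E] [NormedAddCommGroup F] [InnerProductSpace ℂ F]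
  [NormedAddCommGroup G] [InnerProductSpace ℂ G]
  [NormedAddCommGroup E'] [InnerProductSpace ℂ E'] [NormedAddCommGroup F'] [InnerProductSpace ℂ F']

/-- The elementary tensor `x ⊗ y` in the Hilbert space tensor product. -/
def htmul (x : E) (y : F) : HilbertTensor E F := ((x ⊗ₜ[ℂ] y : E ⊗[ℂ] F) : HilbertTensor E F)

/-- The bounded operator `A ⊗ B`. -/
def opTensor (A : E →L[ℂ] E') (B : F →L[ℂ] F') : HilbertTensor E F →L[ℂ] HilbertTensor E' F' :=
  (TensorProduct.mapL A B).completion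

theorem opTensor_htmul (A : E →L[ℂ] E') (B : F →L[ℂ] F') (x : E) (y : F) :
    opTensor A B (htmul x y) = htmul (A x) (B y) := by
  simp [opTensor, htmul]

/-- The map `y ↦ x ⊗ y`. -/
def htmulLeft (F : Type*) [NormedAddCommGroup F] [InnerProductSpace ℂ F] (x : E) :
    F →L[ℂ] HilbertTensor E F :=
  UniformSpace.Completion.toComplL ∘L TensorProduct.mkL ℂ E F x

theorem htmulLeft_apply (x : E) (y : F) : htmulLeft F x y = htmul x y := rfl

variable (E F G) in
/-- The isometric inclusion of the algebraic `(E ⊗ F) ⊗ G` in the Hilbert space tensor product. -/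
def inclLeft : (E ⊗[ℂ] F) ⊗[ℂ] G →ₗᵢ[ℂ] HilbertTensor (HilbertTensor E F) G :=
  UniformSpace.Completion.toComplₗᵢ.comp
    (LinearIsometry.rTensor G (UniformSpace.Completion.toComplₗᵢ (𝕜 := ℂ) (E := E ⊗[ℂ] F)))

variable (E F G) in
/-- The isometric inclusion of the algebraic `E ⊗ (F ⊗ G)` in the Hilbert space tensor product. -/
def inclRight : E ⊗[ℂ] (F ⊗[ℂ] G) →ₗᵢ[ℂ] HilbertTensor E (HilbertTensor F G) :=
  UniformSpace.Completion.toComplₗᵢ.comp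
    (LinearIsometry.lTensor E (UniformSpace.Completion.toComplₗᵢ (𝕜 := ℂ) (E := F ⊗[ℂ] G)))

theorem denseRange_inclLeft : DenseRange (inclLeft E F G) := by
  refine UniformSpace.Completion.denseRange_coe.comp ?_
    (UniformSpace.Completion.continuous_coe _)
  intro t
  set L := LinearIsometry.rTensor G (UniformSpace.Completion.toComplₗᵢ (𝕜 := ℂ) (E := E ⊗[ℂ] F))
  change t ∈ closure (Set.range L)
  induction t using TensorProduct.induction_on with
  | zero => exact subset_closure ⟨0, map_zero L⟩
  | add a b ha hb =>
    refine map_mem_closure₂ continuous_add ha hb ?_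
    rintro _ ⟨a, rfl⟩ _ ⟨b, rfl⟩
    exact ⟨a + b, map_add L a b⟩
  | tmul a z =>
    have hc : Continuous fun a : HilbertTensor E F => a ⊗ₜ[ℂ] z := by fun_prop
    refine UniformSpace.Completion.induction_on a
      (isClosed_closure.preimage hc) fun b => ?_
    exact subset_closure ⟨b ⊗ₜ z, by simp [L]⟩

theorem denseRange_inclRight : DenseRange (inclRight E F G) := by
  refine UniformSpace.Completion.denseRange_coe.comp ?_
    (UniformSpace.Completion.continuous_coe _)
  intro t
  set L := LinearIsometry.lTensor E (UniformSpace.Completion.toComplₗᵢ (𝕜 := ℂ) (E := F ⊗[ℂ] G))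
  change t ∈ closure (Set.range L)
  induction t using TensorProduct.induction_on with
  | zero => exact subset_closure ⟨0, map_zero L⟩
  | add a b ha hb =>
    refine map_mem_closure₂ continuous_add ha hb ?_
    rintro _ ⟨a, rfl⟩ _ ⟨b, rfl⟩
    exact ⟨a + b, map_add L a b⟩
  | tmul z a =>
    have hc : Continuous fun a : HilbertTensor F G => z ⊗ₜ[ℂ] a := by fun_prop
    refine UniformSpace.Completion.induction_on a
      (isClosed_closure.preimage hc) fun b => ?_
    exact subset_closure ⟨z ⊗ₜ b, by simp [L]⟩

variable (E F G) in
/-- The canonical unitary `(E ⊗ F) ⊗ G → E ⊗ (F ⊗ G)`. -/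
def hassoc : HilbertTensor (HilbertTensor E F) G ≃ₗᵢ[ℂ] HilbertTensor E (HilbertTensor F G) :=
  (TensorProduct.assocIsometry ℂ E F G).toLinearEquiv.extendOfIsometry
    (inclLeft E F G).toLinearMap (inclRight E F G).toLinearMap
    denseRange_inclLeft denseRange_inclRight (by
      intro x
      exact ((inclRight E F G).norm_map _).trans
        (((TensorProduct.assocIsometry ℂ E F G).norm_map x).trans
          ((inclLeft E F G).norm_map x).symm))

theorem hassoc_htmul (x : E) (y : F) (z : G) :
    hassoc E F G (htmul (htmul x y) z) = htmul x (htmul y z) := by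
  have h1 : htmul (htmul x y) z = (inclLeft E F G).toLinearMap ((x ⊗ₜ y) ⊗ₜ z) := by
    simp [htmul, inclLeft]
  rw [h1, hassoc, LinearEquiv.extendOfIsometry_eq]
  simp [htmul, inclRight]

end Tensor

/-! ### Spatial tensor products of operator spaces -/

/-- The spatial (minimal) tensor product of two spaces `V`, `W` of operators on `E` and `K`: the
norm closure of the span of the operators `Y ⊗ Z` on `E ⊗ K`, with `Y ∈ V` and `Z ∈ W`. -/
def minTensor {E K : Type*} [NormedAddCommGroup E] [InnerProductSpace ℂ E]
    [NormedAddCommGroup K] [InnerProductSpace ℂ K]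
    (V : Submodule ℂ (E →L[ℂ] E)) (W : Submodule ℂ (K →L[ℂ] K)) :
    Submodule ℂ (HilbertTensor E K →L[ℂ] HilbertTensor E K) :=
  (Submodule.span ℂ {T | ∃ Y ∈ V, ∃ Z ∈ W, T = opTensor Y Z}).topologicalClosure

/-- The space `B(E) ⊗_min B(K)`, as a type. -/
abbrev MinOp (E K : Type*) [NormedAddCommGroup E] [InnerProductSpace ℂ E]
    [NormedAddCommGroup K] [InnerProductSpace ℂ K] : Type _ :=
  (minTensor (⊤ : Submodule ℂ (E →L[ℂ] E)) (⊤ : Submodule ℂ (K →L[ℂ] K)))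

/-! ### The full Fock space and the creation operators -/

/-- The full Fock space on `n` generators, written in its canonical orthonormal basis `e_α` indexed
by the words `α` of the free monoid. -/
abbrev Fock (n : ℕ) : Type := lp (fun _ : FreeMonoid (Fin n) => ℂ) 2

/-- The canonical orthonormal basis of the full Fock space; `e_α = e_{i₁} ⊗ ⋯ ⊗ e_{iₖ}` for
`α = g_{i₁} ⋯ g_{iₖ}`. -/
def fockBasis (n : ℕ) : HilbertBasis (FreeMonoid (Fin n)) ℂ (Fock n) :=
  HilbertBasis.ofRepr (LinearIsometryEquiv.refl ℂ (Fock n))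

/-- The isometry of the full Fock space that sends `e_α` to `e_{σ α}`. -/
def wordShift {n : ℕ} (σ : FreeMonoid (Fin n) → FreeMonoid (Fin n))
    (hσ : Function.Injective σ) : Fock n →ₗᵢ[ℂ] Fock n :=
  ((fockBasis n).orthonormal.comp σ hσ).orthogonalFamily.linearIsometry

theorem wordShift_fockBasis {n : ℕ} (σ : FreeMonoid (Fin n) → FreeMonoid (Fin n))
    (hσ : Function.Injective σ) (α : FreeMonoid (Fin n)) :
    wordShift σ hσ (fockBasis n α) = fockBasis n (σ α) := by
  classical
  have h : fockBasis n α = lp.single 2 α (1 : ℂ) := by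
    rw [← (fockBasis n).repr_symm_single α]
    rfl
  rw [h, wordShift, OrthogonalFamily.linearIsometry_apply_single]
  simp

/-- The left creation operators `S_i φ = e_i ⊗ φ`. -/
def leftCreation {n : ℕ} (i : Fin n) : Fock n →L[ℂ] Fock n :=
  (wordShift (fun α => FreeMonoid.of i * α)
    (fun _ _ h => mul_left_cancel h)).toContinuousLinearMap

/-- The right creation operators `R_i φ = φ ⊗ e_i`. -/
def rightCreation {n : ℕ} (i : Fin n) : Fock n →L[ℂ] Fock n :=
  (wordShift (fun α => α * FreeMonoid.of i)
    (fun _ _ h => mul_right_cancel h)).toContinuousLinearMap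

theorem leftCreation_fockBasis {n : ℕ} (i : Fin n) (α : FreeMonoid (Fin n)) :
    leftCreation i (fockBasis n α) = fockBasis n (FreeMonoid.of i * α) :=
  wordShift_fockBasis _ (fun _ _ h => mul_left_cancel h) _

theorem rightCreation_fockBasis {n : ℕ} (i : Fin n) (α : FreeMonoid (Fin n)) :
    rightCreation i (fockBasis n α) = fockBasis n (α * FreeMonoid.of i) :=
  wordShift_fockBasis _ (fun _ _ h => mul_right_cancel h) _

/-- The noncommutative disc algebra `𝒜_n`: the norm closed algebra generated by the left creation
operators and the identity. -/
def discAlgebra (n : ℕ) : Subalgebra ℂ (Fock n →L[ℂ] Fock n) :=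
  (Algebra.adjoin ℂ (Set.range (leftCreation (n := n)))).topologicalClosure

/-! ### The noncommutative balls -/

section Balls

variable {K : Type*} [NormedAddCommGroup K] [InnerProductSpace ℂ K] [CompleteSpace K]

/-- The norm `‖X₁ X₁* + ⋯ + X_n X_n*‖^{1/2}` of an `n`-tuple, as a row operator. -/
def rowNorm {n : ℕ} (X : Fin n → K →L[ℂ] K) : ℝ :=
  Real.sqrt ‖∑ i, X i ∘L (X i).adjoint‖

/-- The open noncommutative ball `[B(K)^n]_1`, with the topology of the operator norm. -/
abbrev OpenBall (n : ℕ) (K : Type*) [NormedAddCommGroup K] [InnerProductSpace ℂ K]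
    [CompleteSpace K] : Type _ :=
  {X : Fin n → K →L[ℂ] K // rowNorm X < 1}

/-- The closed noncommutative ball `[B(K)^n]_1^-`, with the topology of the operator norm. -/
abbrev ClosedBall (n : ℕ) (K : Type*) [NormedAddCommGroup K] [InnerProductSpace ℂ K]
    [CompleteSpace K] : Type _ :=
  {X : Fin n → K →L[ℂ] K // rowNorm X ≤ 1}

end Balls

theorem adjoint_leftCreation_comp {n : ℕ} (i j : Fin n) :
    (leftCreation i).adjoint ∘L leftCreation j = if i = j then 1 else 0 := by
  classical
  have hd : Dense (Submodule.span ℂ (Set.range (fockBasis n)) : Set (Fock n)) :=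
    Submodule.dense_iff_topologicalClosure_eq_top.mpr (fockBasis n).dense_span
  refine ContinuousLinearMap.ext_on hd ?_
  rintro _ ⟨α, rfl⟩
  refine (fockBasis n).repr.injective (lp.ext (funext fun β => ?_))
  rw [HilbertBasis.repr_apply_apply, HilbertBasis.repr_apply_apply,
    ContinuousLinearMap.comp_apply, ContinuousLinearMap.adjoint_inner_right,
    leftCreation_fockBasis, leftCreation_fockBasis]
  have ho := orthonormal_iff_ite.mp (fockBasis n).orthonormal
  by_cases h : i = j
  · subst h
    have h2 : FreeMonoid.of i * β = FreeMonoid.of i * α ↔ β = α := mul_right_inj _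
    simp [ho, h2]
  · have h2 : ¬ (FreeMonoid.of i * β = FreeMonoid.of j * α) := fun h3 =>
      h (List.cons.inj (congrArg FreeMonoid.toList h3)).1
    rw [ho, if_neg h2, if_neg h]
    simp

theorem norm_sum_leftCreation_le (n : ℕ) :
    ‖∑ i : Fin n, leftCreation i ∘L (leftCreation i).adjoint‖ ≤ 1 := by
  set P : Fock n →L[ℂ] Fock n := ∑ i : Fin n, leftCreation i ∘L (leftCreation i).adjoint with hP
  have hs : star P = P := by
    simp only [hP, star_sum]
    refine Finset.sum_congr rfl fun i _ => ?_
    rw [ContinuousLinearMap.star_eq_adjoint, ContinuousLinearMap.adjoint_comp,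
      ContinuousLinearMap.adjoint_adjoint]
  have hm : P * P = P := by
    simp only [hP, Finset.sum_mul, Finset.mul_sum]
    refine Finset.sum_congr rfl fun i _ => ?_
    rw [Finset.sum_eq_single i]
    · ext1 x
      have h := DFunLike.congr_fun (adjoint_leftCreation_comp i i) ((leftCreation i).adjoint x)
      simp only [ContinuousLinearMap.comp_apply, if_true, one_apply_eq_self] at h
      simp [h]
    · intro j _ hj
      ext1 x
      have h := DFunLike.congr_fun (adjoint_leftCreation_comp j i) ((leftCreation i).adjoint x)
      simp only [ContinuousLinearMap.comp_apply, if_neg hj, zero_apply] at h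
      simp [h]
    · simp
  have hn : ‖P‖ * ‖P‖ = ‖P‖ := by
    have h := CStarRing.norm_star_mul_self (x := P)
    rw [hs, hm] at h
    exact h.symm
  nlinarith [norm_nonneg P]

/-- The tuple `rS = (rS₁, …, rS_n)`, for `0 ≤ r < 1`, as a point of the open ball. -/
def scaledCreation (n : ℕ) (r : Set.Ico (0 : ℝ) 1) : OpenBall n (Fock n) :=
  ⟨fun i => ((r : ℝ) : ℂ) • leftCreation i, by
    have h1 : ∑ i : Fin n, (((r : ℝ) : ℂ) • leftCreation i) ∘L
        (((r : ℝ) : ℂ) • leftCreation i).adjoint =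
        (((r : ℝ) : ℂ) * ((r : ℝ) : ℂ)) •
          ∑ i : Fin n, leftCreation i ∘L (leftCreation i).adjoint := by
      rw [Finset.smul_sum]
      refine Finset.sum_congr rfl fun i _ => ?_
      rw [map_smulₛₗ, ContinuousLinearMap.smul_comp, ContinuousLinearMap.comp_smul, smul_smul,
        Complex.conj_ofReal]
    have h0 := r.2.1
    have hr := r.2.2
    have h2 := norm_sum_leftCreation_le n
    rw [rowNorm, h1, norm_smul, Real.sqrt_lt' one_pos, norm_mul, Complex.norm_real,
      Real.norm_of_nonneg h0]
    nlinarith [norm_nonneg (∑ i : Fin n, leftCreation i ∘L (leftCreation i).adjoint)]⟩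

/-! ### Free holomorphic and free pluriharmonic functions -/

section Functions

variable {n : ℕ} {E H K : Type*}
  [NormedAddCommGroup E] [InnerProductSpace ℂ E] [CompleteSpace E]
  [NormedAddCommGroup H] [InnerProductSpace ℂ H] [CompleteSpace H]
  [NormedAddCommGroup K] [InnerProductSpace ℂ K] [CompleteSpace K]

/-- The word `g_{w 0} ⋯ g_{w (k-1)}`; as `w` varies, these are all the words of length `k`. -/
def word {k : ℕ} (w : Fin k → Fin n) : FreeMonoid (Fin n) := FreeMonoid.ofList (List.ofFn w)

/-- The radius of convergence `R ∈ [0, ∞]` of a formal power series `∑ A_α ⊗ Z_α`, where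
`1 / R = limsup_k ‖∑_{|α| = k} A_α* A_α‖^{1/2k}`. -/
def radiusOfConvergence (A : FreeMonoid (Fin n) → E →L[ℂ] E) : ENNReal :=
  (Filter.limsup (fun k : ℕ =>
    ‖∑ w : Fin k → Fin n, (A (word w)).adjoint ∘L A (word w)‖ₑ ^ (1 / (2 * k : ℝ)))
    Filter.atTop)⁻¹

/-- The homogeneous part `∑_{|α| = k} A_α ⊗ X_α`; here `X_α = X_{i₁} ⋯ X_{iₖ}`. -/
def homogeneousPart (A : FreeMonoid (Fin n) → E →L[ℂ] E) (X : Fin n → K →L[ℂ] K) (k : ℕ) :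
    HilbertTensor E K →L[ℂ] HilbertTensor E K :=
  ∑ w : Fin k → Fin n, opTensor (A (word w)) (FreeMonoid.lift X (word w))

/-- `F` is the free holomorphic function on the open ball of `B(K)^n` with coefficients `A_α`. -/
def IsFreeHolomorphicWith (A : FreeMonoid (Fin n) → E →L[ℂ] E)
    (F : OpenBall n K → MinOp E K) : Prop :=
  1 ≤ radiusOfConvergence A ∧
    ∀ X : OpenBall n K, HasSum (homogeneousPart A X.1)
      (F X : HilbertTensor E K →L[ℂ] HilbertTensor E K)

/-- The real part `(T + T*) / 2` of an operator. -/
def rePart (T : K →L[ℂ] K) : K →L[ℂ] K := (1 / 2 : ℂ) • (T + T.adjoint)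

/-- `u = Re F₁ + i Re F₂` on the open ball of `B(K)^n`, where `F₁` and `F₂` are the free holomorphic
functions with coefficients `A₁` and `A₂`. -/
def IsFreePluriharmonicWith (A₁ A₂ : FreeMonoid (Fin n) → E →L[ℂ] E)
    (u : OpenBall n K → MinOp E K) : Prop :=
  ∃ F₁ F₂ : OpenBall n K → MinOp E K,
    IsFreeHolomorphicWith A₁ F₁ ∧ IsFreeHolomorphicWith A₂ F₂ ∧
    ∀ X, (u X : HilbertTensor E K →L[ℂ] HilbertTensor E K) =
      rePart (F₁ X).1 + Complex.I • rePart (F₂ X).1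

/-- Free pluriharmonic functions on the open ball of `B(K)^n`, with coefficients in `B(E)`. -/
def IsFreePluriharmonic (u : OpenBall n K → MinOp E K) : Prop :=
  ∃ A₁ A₂, IsFreePluriharmonicWith A₁ A₂ u

/-- `v` is the representation on the full Fock space of the free pluriharmonic function `u`: both
are given by the same coefficients. The values `u(rS₁, …, rS_n)` are the values of `v` at `rS`. -/
def IsFockRepresentation (u : OpenBall n H → MinOp E H)
    (v : OpenBall n (Fock n) → MinOp E (Fock n)) : Prop :=
  ∃ A₁ A₂, IsFreePluriharmonicWith A₁ A₂ u ∧ IsFreePluriharmonicWith A₁ A₂ v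

/-- `v(rS₁, …, rS_n)` converges to `f` in the operator norm as `r → 1`, `0 ≤ r < 1`. -/
def RadialLimit (v : OpenBall n (Fock n) → MinOp E (Fock n))
    (f : HilbertTensor E (Fock n) →L[ℂ] HilbertTensor E (Fock n)) : Prop :=
  Filter.Tendsto
    (fun r : Set.Ico (0 : ℝ) 1 =>
      (v (scaledCreation n r) : HilbertTensor E (Fock n) →L[ℂ] HilbertTensor E (Fock n)))
    (Filter.comap Subtype.val (𝓝 1)) (𝓝 f)

/-- `u` has a continuous extension, in the operator norm topology, to the closed ball. -/
def HasContinuousExtension (u : OpenBall n H → MinOp E H) : Prop :=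
  ∃ w : ClosedBall n H → MinOp E H, Continuous w ∧
    ∀ X : OpenBall n H, w ⟨X.1, X.2.le⟩ = u X

/-! ### The boundary functions -/

variable (n E) in
/-- The space `𝒜_n(E) = B(E) ⊗_min 𝒜_n`. -/
def discSpace : Submodule ℂ (HilbertTensor E (Fock n) →L[ℂ] HilbertTensor E (Fock n)) :=
  minTensor ⊤ (Subalgebra.toSubmodule (discAlgebra n))

variable (n E) in
/-- The norm closure of `𝒜_n(E)* + 𝒜_n(E)`. -/
def boundarySpace : Submodule ℂ (HilbertTensor E (Fock n) →L[ℂ] HilbertTensor E (Fock n)) :=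
  ((discSpace n E).map (starLinearEquiv ℂ :
    (HilbertTensor E (Fock n) →L[ℂ] HilbertTensor E (Fock n)) ≃ₗ⋆[ℂ] _).toLinearMap ⊔
      discSpace n E).topologicalClosure

/-! ### The noncommutative Poisson transform -/

/-- The defect operator `Δ_X = (I - X₁ X₁* - ⋯ - X_n X_n*)^{1/2}`. -/
def defect (X : Fin n → H →L[ℂ] H) : H →L[ℂ] H :=
  CFC.sqrt (1 - ∑ i, X i ∘L (X i).adjoint)

/-- The Berezin kernel `B_X = (I ⊗ Δ_X) (I - R₁ ⊗ X₁* - ⋯ - R_n ⊗ X_n*)⁻¹`. For `X` in the open ball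
the operator `R₁ ⊗ X₁* + ⋯ + R_n ⊗ X_n*` has norm less than one. -/
def berezinKernel (X : Fin n → H →L[ℂ] H) :
    HilbertTensor (Fock n) H →L[ℂ] HilbertTensor (Fock n) H :=
  opTensor (ContinuousLinearMap.id ℂ (Fock n)) (defect X) ∘L
    Ring.inverse (1 - ∑ i, opTensor (rightCreation i) (X i).adjoint)

/-- The Poisson kernel `K_X = B_X|_{1 ⊗ H} : H → F² ⊗ H`. -/
def ncPoissonKernel (X : Fin n → H →L[ℂ] H) : H →L[ℂ] HilbertTensor (Fock n) H :=
  berezinKernel X ∘L htmulLeft H (fockBasis n 1)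

/-- The operator-valued Poisson transform
`P_X[f] = (I_E ⊗ K_X*) (f ⊗ I_H) (I_E ⊗ K_X)`, with `E ⊗ (F² ⊗ H)` and `(E ⊗ F²) ⊗ H` identified
in the canonical way. -/
def poissonTransform (X : Fin n → H →L[ℂ] H)
    (f : HilbertTensor E (Fock n) →L[ℂ] HilbertTensor E (Fock n)) :
    HilbertTensor E H →L[ℂ] HilbertTensor E H :=
  opTensor (ContinuousLinearMap.id ℂ E) (ncPoissonKernel X).adjoint ∘L
    (hassoc E (Fock n) H).toContinuousLinearEquiv.toContinuousLinearMap ∘L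
    opTensor f (ContinuousLinearMap.id ℂ H) ∘L
    (hassoc E (Fock n) H).symm.toContinuousLinearEquiv.toContinuousLinearMap ∘L
    opTensor (ContinuousLinearMap.id ℂ E) (ncPoissonKernel X)

end Functions

/-! ### Matrices of operators -/

/-- The operator on the Hilbert space direct sum `K^{(m)}` given by an `m × m` matrix of operators;
its operator norm is the norm of the matrix in `M_m(B(K))`. -/
def matrixOp {m : ℕ} {K : Type*} [NormedAddCommGroup K] [InnerProductSpace ℂ K]
    (T : Fin m → Fin m → K →L[ℂ] K) :
    PiLp 2 (fun _ : Fin m => K) →L[ℂ] PiLp 2 (fun _ : Fin m => K) :=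
  (PiLp.continuousLinearEquiv 2 ℂ (fun _ : Fin m => K)).symm.toContinuousLinearMap ∘L
    ContinuousLinearMap.pi (fun i => ∑ j, T i j ∘L PiLp.proj 2 (fun _ : Fin m => K) j)

theorem matrixOp_apply {m : ℕ} {K : Type*} [NormedAddCommGroup K] [InnerProductSpace ℂ K]
    (T : Fin m → Fin m → K →L[ℂ] K) (x : PiLp 2 (fun _ : Fin m => K)) (i : Fin m) :
    matrixOp T x i = ∑ j, T i j (x j) := by
  simp [matrixOp]

end FreePluri

end

noncomputable section

namespace FreePluri

/-! ### Calculus of operators on Hilbert space tensor products -/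

section TensorCalculus

variable {E F G E' F' G' E'' F'' : Type*}
  [NormedAddCommGroup E] [InnerProductSpace ℂ E] [NormedAddCommGroup F] [InnerProductSpace ℂ F]
  [NormedAddCommGroup G] [InnerProductSpace ℂ G]
  [NormedAddCommGroup E'] [InnerProductSpace ℂ E'] [NormedAddCommGroup F'] [InnerProductSpace ℂ F']
  [NormedAddCommGroup G'] [InnerProductSpace ℂ G']
  [NormedAddCommGroup E''] [InnerProductSpace ℂ E'']
  [NormedAddCommGroup F''] [InnerProductSpace ℂ F'']

/-! The Poisson kernel `K_X` is an isometry with `(S_j* ⊗ I) K_X = K_X X_j*`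
(`norm_ncPoissonKernel_apply`, `adjoint_leftCreation_ncPoissonKernel`). Hence `P_X[Y ⊗ S_α] = Y ⊗
X_α`, and `P_X` is completely contractive and commutes with adjoints. The boundary space is the
closed span of the operators `Y ⊗ S_α` and their adjoints, so any closed linear property of a
boundary function need only be checked on these (`boundarySpace_le`).

(ii) ⇒ (i). The entries of `f` from the vacuum to the `e_α` form columns of norm at most `‖f‖`, by
Bessel, so they define a power series on the open ball. The formula expressing `P_X[f]` through the
coefficients of `f` and `f*` (`poissonTransform_eq_powerSum`) is bounded and linear in `f`, hence
follows from the generators. On generators `P_X` is uniformly continuous in `X`; contractivity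
passes this to the closure, and a uniformly continuous function extends to the closed ball.

(i) ⇒ (iii). As `H` is infinite dimensional, there is an isometry `V` from the Fock space into `H`.
The tuple `T_i = V S_i V*` lies in the closed ball, and compressing `u(rT)` by `I ⊗ V` gives
`u(rS)`. Continuity of the extension at `T` yields the radial limit.

(iii) ⇒ (ii). Each `u(rS)` is in the boundary space, which is closed, and `P_X[u(rS)] = u(rX)`.
Letting `r → 1` represents `u` by the radial limit.

Conversely `P_{rS}[f] → f` for each boundary function `f`. This shows that `f` is recovered from
`u`, so the Poisson map is injective; its range is the space of functions in (i), and `Φ` is its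
inverse. For matrices, complete contractivity of `P_X` gives one inequality, while the compressions
of `P_{rT}[f_ij]`, which converge to `f_ij`, give the other. -/

theorem tensor_ext {W : Type*} [NormedAddCommGroup W] [NormedSpace ℂ W]
    {S T : HilbertTensor E F →L[ℂ] W} (h : ∀ x y, S (htmul x y) = T (htmul x y)) : S = T := by
  have h1 : (S ∘L UniformSpace.Completion.toComplL).toLinearMap =
      (T ∘L UniformSpace.Completion.toComplL).toLinearMap := TensorProduct.ext' h
  ext ξ
  exact UniformSpace.Completion.induction_on ξ (isClosed_eq S.continuous T.continuous)
    fun t => LinearMap.congr_fun h1 t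

theorem inner_htmul (x x' : E) (y y' : F) :
    inner ℂ (htmul x y) (htmul x' y') = inner ℂ x x' * inner ℂ y y' := by
  simp [htmul, UniformSpace.Completion.inner_coe]

theorem norm_htmul (x : E) (y : F) : ‖htmul x y‖ = ‖x‖ * ‖y‖ := by
  simp [htmul]

/-- The map `x ↦ x ⊗ y`. -/
def htmulRight (E : Type*) [NormedAddCommGroup E] [InnerProductSpace ℂ E] (y : F) :
    E →L[ℂ] HilbertTensor E F :=
  UniformSpace.Completion.toComplL ∘L (TensorProduct.mkL ℂ E F).flip y

theorem htmulRight_apply (x : E) (y : F) : htmulRight E y x = htmul x y := rfl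

theorem htmul_add_left (x x' : E) (y : F) : htmul (x + x') y = htmul x y + htmul x' y :=
  map_add (htmulRight E y) x x'

theorem htmul_add_right (x : E) (y y' : F) : htmul x (y + y') = htmul x y + htmul x y' :=
  map_add (htmulLeft F x) y y'

theorem htmul_smul_left (c : ℂ) (x : E) (y : F) : htmul (c • x) y = c • htmul x y :=
  map_smul (htmulRight E y) c x

theorem htmul_smul_right (c : ℂ) (x : E) (y : F) : htmul x (c • y) = c • htmul x y :=
  map_smul (htmulLeft F x) c y

theorem tensor_eq_of_inner {ξ η : HilbertTensor E F}
    (h : ∀ x y, inner ℂ (htmul x y) ξ = inner ℂ (htmul x y) η) : ξ = η := by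
  have h1 : innerSL ℂ ξ = innerSL ℂ η := tensor_ext fun x y => by
    rw [innerSL_apply_apply, innerSL_apply_apply, ← inner_conj_symm, h, inner_conj_symm]
  exact (innerSL_inj (𝕜 := ℂ)).1 h1

theorem opTensor_comp (A : E' →L[ℂ] E'') (A' : E →L[ℂ] E') (B : F' →L[ℂ] F'') (B' : F →L[ℂ] F') :
    opTensor (A ∘L A') (B ∘L B') = opTensor A B ∘L opTensor A' B' :=
  tensor_ext fun x y => by simp [opTensor_htmul]

theorem opTensor_id : opTensor (ContinuousLinearMap.id ℂ E) (ContinuousLinearMap.id ℂ F) =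
    ContinuousLinearMap.id ℂ (HilbertTensor E F) :=
  tensor_ext fun x y => by simp [opTensor_htmul]

theorem opTensor_add_left (A A' : E →L[ℂ] E') (B : F →L[ℂ] F') :
    opTensor (A + A') B = opTensor A B + opTensor A' B :=
  tensor_ext fun x y => by simp [opTensor_htmul, htmul_add_left]

theorem opTensor_add_right (A : E →L[ℂ] E') (B B' : F →L[ℂ] F') :
    opTensor A (B + B') = opTensor A B + opTensor A B' :=
  tensor_ext fun x y => by simp [opTensor_htmul, htmul_add_right]

theorem opTensor_smul_left (c : ℂ) (A : E →L[ℂ] E') (B : F →L[ℂ] F') :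
    opTensor (c • A) B = c • opTensor A B :=
  tensor_ext fun x y => by simp [opTensor_htmul, htmul_smul_left]

theorem opTensor_smul_right (c : ℂ) (A : E →L[ℂ] E') (B : F →L[ℂ] F') :
    opTensor A (c • B) = c • opTensor A B :=
  tensor_ext fun x y => by simp [opTensor_htmul, htmul_smul_right]

theorem norm_opTensor_le (A : E →L[ℂ] E') (B : F →L[ℂ] F') : ‖opTensor A B‖ ≤ ‖A‖ * ‖B‖ := by
  refine ContinuousLinearMap.opNorm_le_bound _ (by positivity) fun ξ => ?_
  refine UniformSpace.Completion.induction_on ξ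
    (isClosed_le (by fun_prop) (by fun_prop)) fun t => ?_
  rw [opTensor, ContinuousLinearMap.completion_apply_coe, UniformSpace.Completion.norm_coe,
    UniformSpace.Completion.norm_coe]
  exact (TensorProduct.mapL A B).le_of_opNorm_le (TensorProduct.norm_mapL_le A B) t

/-- The bounded linear map `B ↦ A ⊗ B`. -/
def opTensorL (F F' : Type*) [NormedAddCommGroup F] [InnerProductSpace ℂ F]
    [NormedAddCommGroup F'] [InnerProductSpace ℂ F'] (A : E →L[ℂ] E') :
    (F →L[ℂ] F') →L[ℂ] (HilbertTensor E F →L[ℂ] HilbertTensor E' F') :=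
  LinearMap.mkContinuous (IsLinearMap.mk' (fun B : F →L[ℂ] F' => opTensor A B)
    ⟨opTensor_add_right A, fun c => opTensor_smul_right c A⟩) ‖A‖ fun B => by
      rw [IsLinearMap.mk'_apply]; exact norm_opTensor_le A B

theorem opTensorL_apply (A : E →L[ℂ] E') (B : F →L[ℂ] F') : opTensorL F F' A B = opTensor A B := rfl

/-- The bounded linear map `A ↦ A ⊗ B`. -/
def opTensorR (E E' : Type*) [NormedAddCommGroup E] [InnerProductSpace ℂ E]
    [NormedAddCommGroup E'] [InnerProductSpace ℂ E'] (B : F →L[ℂ] F') :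
    (E →L[ℂ] E') →L[ℂ] (HilbertTensor E F →L[ℂ] HilbertTensor E' F') :=
  LinearMap.mkContinuous (IsLinearMap.mk' (fun A : E →L[ℂ] E' => opTensor A B)
    ⟨fun A A' => opTensor_add_left A A' B, fun c A => opTensor_smul_left c A B⟩) ‖B‖ fun A => by
      rw [IsLinearMap.mk'_apply, mul_comm]; exact norm_opTensor_le A B

theorem opTensorR_apply (A : E →L[ℂ] E') (B : F →L[ℂ] F') : opTensorR E E' B A = opTensor A B := rfl

/-- Naturality of the associator; it lets `(Y ⊗ Z) ⊗ I` be read as `Y ⊗ (Z ⊗ I)` inside the Poisson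
transform. -/
theorem hassoc_comp_opTensor (A : E →L[ℂ] E') (B : F →L[ℂ] F') (C : G →L[ℂ] G') :
    (hassoc E' F' G').toContinuousLinearEquiv.toContinuousLinearMap ∘L opTensor (opTensor A B) C =
      opTensor A (opTensor B C) ∘L
        (hassoc E F G).toContinuousLinearEquiv.toContinuousLinearMap := by
  refine tensor_ext fun ξ z => ?_
  -- Here `ξ` is an arbitrary vector of the completed `E ⊗ F`; fixing `z` and regarding both sides
  -- as operators in `ξ` allows a second reduction to elementary tensors.
  have h : ((hassoc E' F' G').toContinuousLinearEquiv.toContinuousLinearMap ∘L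
        opTensor (opTensor A B) C) ∘L
          (UniformSpace.Completion.toComplL ∘L (TensorProduct.mkL ℂ _ G).flip z) =
      (opTensor A (opTensor B C) ∘L (hassoc E F G).toContinuousLinearEquiv.toContinuousLinearMap) ∘L
          (UniformSpace.Completion.toComplL ∘L (TensorProduct.mkL ℂ _ G).flip z) := by
    refine tensor_ext fun x y => ?_
    change hassoc E' F' G' (opTensor (opTensor A B) C (htmul (htmul x y) z)) =
      opTensor A (opTensor B C) (hassoc E F G (htmul (htmul x y) z))
    simp only [hassoc_htmul, opTensor_htmul]
  exact DFunLike.congr_fun h ξ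

variable [CompleteSpace E] [CompleteSpace F] [CompleteSpace E'] [CompleteSpace F']

theorem adjoint_opTensor (A : E →L[ℂ] E') (B : F →L[ℂ] F') :
    (opTensor A B).adjoint = opTensor A.adjoint B.adjoint := by
  refine tensor_ext fun x y => tensor_eq_of_inner fun x' y' => ?_
  rw [ContinuousLinearMap.adjoint_inner_right, opTensor_htmul, opTensor_htmul, inner_htmul,
    inner_htmul, ContinuousLinearMap.adjoint_inner_right, ContinuousLinearMap.adjoint_inner_right]

omit [CompleteSpace E'] [CompleteSpace F'] in
-- Needed for real parts of `MinOp`-valued functions to stay in the spatial tensor product.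
theorem minTensor_top_adjoint {T : HilbertTensor E F →L[ℂ] HilbertTensor E F}
    (hT : T ∈ minTensor (⊤ : Submodule ℂ (E →L[ℂ] E)) (⊤ : Submodule ℂ (F →L[ℂ] F))) :
    T.adjoint ∈ minTensor (⊤ : Submodule ℂ (E →L[ℂ] E)) (⊤ : Submodule ℂ (F →L[ℂ] F)) := by
  have hc : Continuous fun T : HilbertTensor E F →L[ℂ] HilbertTensor E F => T.adjoint :=
    (ContinuousLinearMap.adjoint (𝕜 := ℂ) (E := HilbertTensor E F)
      (F := HilbertTensor E F)).continuous
  refine map_mem_closure hc hT fun S hS => ?_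
  induction hS using Submodule.span_induction with
  | mem x hx =>
    obtain ⟨Y, -, Z, -, rfl⟩ := hx
    exact Submodule.subset_span ⟨_, trivial, _, trivial, adjoint_opTensor Y Z⟩
  | zero => simp
  | add x y _ _ hx hy => rw [map_add]; exact add_mem hx hy
  | smul a x _ hx => rw [map_smulₛₗ]; exact Submodule.smul_mem _ _ hx

omit [CompleteSpace E] [CompleteSpace F] in
theorem opTensor_mem_minTensor {V : Submodule ℂ (E →L[ℂ] E)} {W : Submodule ℂ (F →L[ℂ] F)}
    {Y : E →L[ℂ] E} {Z : F →L[ℂ] F} (hY : Y ∈ V) (hZ : Z ∈ W) : opTensor Y Z ∈ minTensor V W :=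
  Submodule.le_topologicalClosure _ (Submodule.subset_span ⟨Y, hY, Z, hZ, rfl⟩)

end TensorCalculus

/-! ### Column estimates -/

section Columns

variable {K L M N : Type*} {ι : Type*} [Fintype ι]
  [NormedAddCommGroup K] [InnerProductSpace ℂ K] [CompleteSpace K]
  [NormedAddCommGroup L] [InnerProductSpace ℂ L] [CompleteSpace L]
  [NormedAddCommGroup M] [InnerProductSpace ℂ M] [CompleteSpace M]
  [NormedAddCommGroup N] [InnerProductSpace ℂ N] [CompleteSpace N]

theorem sum_norm_sq_eq_re_inner (A : ι → K →L[ℂ] L) (x : K) :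
    ∑ i, ‖A i x‖ ^ 2 = (inner ℂ ((∑ i, (A i).adjoint ∘L A i) x) x : ℂ).re := by
  simp only [sum_apply, sum_inner, Complex.re_sum,
    ContinuousLinearMap.comp_apply, ContinuousLinearMap.adjoint_inner_left]
  exact Finset.sum_congr rfl fun i _ => (inner_self_eq_norm_sq (𝕜 := ℂ) (A i x)).symm

theorem sum_norm_sq_le (A : ι → K →L[ℂ] L) (x : K) :
    ∑ i, ‖A i x‖ ^ 2 ≤ ‖∑ i, (A i).adjoint ∘L A i‖ * ‖x‖ ^ 2 := by
  rw [sum_norm_sq_eq_re_inner]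
  refine (Complex.re_le_norm _).trans ((norm_inner_le_norm _ _).trans ?_)
  have := (∑ i, (A i).adjoint ∘L A i).le_opNorm x
  nlinarith [norm_nonneg x]

/-- Converse of `sum_norm_sq_le`: for unit vectors, `Re ⟨A_i x, A_i y⟩ ≤ (‖A_i x‖² + ‖A_i y‖²) / 2`,
and the sum over `i` of the right side is at most `c`. Together the two lemmas turn operator norms
of columns into scalar inequalities. -/
theorem norm_sum_adjoint_comp_le (A : ι → K →L[ℂ] L) {c : ℝ} (hc : 0 ≤ c)
    (h : ∀ x, ∑ i, ‖A i x‖ ^ 2 ≤ c * ‖x‖ ^ 2) : ‖∑ i, (A i).adjoint ∘L A i‖ ≤ c := by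
  refine ContinuousLinearMap.opNorm_le_of_re_inner_le (𝕜 := ℂ) hc fun x y hx hy => ?_
  have hx' := h x
  have hy' := h y
  rw [hx, one_pow, mul_one] at hx'
  rw [hy, one_pow, mul_one] at hy'
  rw [sum_apply, sum_inner, map_sum]
  have h1 : ∀ i, RCLike.re (inner ℂ (((A i).adjoint ∘L A i) x) y : ℂ) ≤
      (‖A i x‖ ^ 2 + ‖A i y‖ ^ 2) / 2 := fun i => by
    rw [ContinuousLinearMap.comp_apply, ContinuousLinearMap.adjoint_inner_left]
    have := (Complex.re_le_norm _).trans (norm_inner_le_norm (𝕜 := ℂ) (A i x) (A i y))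
    have h2 : RCLike.re (inner ℂ (A i x) (A i y) : ℂ) ≤ ‖A i x‖ * ‖A i y‖ := this
    nlinarith [sq_nonneg (‖A i x‖ - ‖A i y‖)]
  refine (Finset.sum_le_sum fun i _ => h1 i).trans ?_
  rw [← Finset.sum_div, Finset.sum_add_distrib]
  linarith

/-- A row times a column. With `y = ∑ B_i A_i x` one has `‖y‖² = ∑ ⟨A_i x, B_i* y⟩`; apply
Cauchy–Schwarz and cancel one factor `‖y‖`. -/
theorem norm_sum_comp_le (A : ι → K →L[ℂ] L) (B : ι → L →L[ℂ] M) :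
    ‖∑ i, B i ∘L A i‖ ≤ Real.sqrt ‖∑ i, B i ∘L (B i).adjoint‖ *
      Real.sqrt ‖∑ i, (A i).adjoint ∘L A i‖ := by
  refine ContinuousLinearMap.opNorm_le_bound _ (by positivity) fun x => ?_
  set c := Real.sqrt ‖∑ i, B i ∘L (B i).adjoint‖
  set d := Real.sqrt ‖∑ i, (A i).adjoint ∘L A i‖
  set y := (∑ i, B i ∘L A i) x with hy
  have h1 : Real.sqrt (∑ i, ‖A i x‖ ^ 2) ≤ d * ‖x‖ := by
    refine (Real.sqrt_le_sqrt (sum_norm_sq_le A x)).trans ?_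
    rw [Real.sqrt_mul (norm_nonneg _), Real.sqrt_sq (norm_nonneg _)]
  have h2 : Real.sqrt (∑ i, ‖(B i).adjoint y‖ ^ 2) ≤ c * ‖y‖ := by
    refine (Real.sqrt_le_sqrt (sum_norm_sq_le (fun i => (B i).adjoint) y)).trans ?_
    simp only [ContinuousLinearMap.adjoint_adjoint]
    rw [Real.sqrt_mul (norm_nonneg _), Real.sqrt_sq (norm_nonneg _)]
  have h3 : ‖y‖ ^ 2 ≤ ∑ i, ‖A i x‖ * ‖(B i).adjoint y‖ := by
    rw [← inner_self_eq_norm_sq (𝕜 := ℂ)]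
    nth_rewrite 1 [hy]
    rw [sum_apply, sum_inner, map_sum]
    refine Finset.sum_le_sum fun i _ => ?_
    rw [ContinuousLinearMap.comp_apply, ← ContinuousLinearMap.adjoint_inner_right]
    exact (Complex.re_le_norm _).trans (norm_inner_le_norm _ _)
  have h4 := h3.trans (Real.sum_mul_le_sqrt_mul_sqrt _ _ _)
  have h5 : ‖y‖ * ‖y‖ ≤ (c * d * ‖x‖) * ‖y‖ := by
    calc ‖y‖ * ‖y‖ = ‖y‖ ^ 2 := (sq _).symm
      _ ≤ _ := h4
      _ ≤ (d * ‖x‖) * (c * ‖y‖) := mul_le_mul h1 h2 (Real.sqrt_nonneg _) (by positivity)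
      _ = _ := by ring
  rcases (norm_nonneg y).eq_or_lt with h | h
  · rw [← h]; positivity
  · exact le_of_mul_le_mul_right h5 h

end Columns

/-! ### Words and row contractions -/

section Words

variable {n : ℕ}

theorem word_zero (w : Fin 0 → Fin n) : word w = 1 := rfl

theorem word_cons {k : ℕ} (i : Fin n) (w : Fin k → Fin n) :
    word (Fin.cons i w : Fin (k + 1) → Fin n) = FreeMonoid.of i * word w := by
  rw [word, List.ofFn_cons]
  rfl

theorem exists_word (α : FreeMonoid (Fin n)) :
    ∃ (k : ℕ) (w : Fin k → Fin n), word w = α :=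
  ⟨_, fun i => (FreeMonoid.toList α).get i, congrArg FreeMonoid.ofList (List.ofFn_get _)⟩

theorem word_length {k : ℕ} (w : Fin k → Fin n) : (word w).toList.length = k := by
  simp [word]

theorem word_injective {k : ℕ} : Function.Injective (word : (Fin k → Fin n) → _) :=
  fun _ _ h => List.ofFn_injective (FreeMonoid.ofList.injective h)

theorem sum_words_succ {M : Type*} [AddCommMonoid M] {k : ℕ} (f : (Fin (k + 1) → Fin n) → M) :
    ∑ w, f w = ∑ i : Fin n, ∑ w : Fin k → Fin n, f (Fin.cons i w) := by
  rw [← Fintype.sum_prod_type']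
  exact (Fintype.sum_equiv (Fin.consEquiv fun _ => Fin n) _ _ fun _ => rfl).symm

/-! ### Row norms of tuples and of their words. -/

variable {K : Type*} [NormedAddCommGroup K] [InnerProductSpace ℂ K] [CompleteSpace K]

theorem rowNorm_nonneg (X : Fin n → K →L[ℂ] K) : 0 ≤ rowNorm X := Real.sqrt_nonneg _

theorem rowNorm_sq (X : Fin n → K →L[ℂ] K) :
    rowNorm X ^ 2 = ‖∑ i, X i ∘L (X i).adjoint‖ := Real.sq_sqrt (norm_nonneg _)

theorem rowNorm_smul (c : ℂ) (X : Fin n → K →L[ℂ] K) : rowNorm (c • X) = ‖c‖ * rowNorm X := by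
  have h : ∑ i, (c • X) i ∘L ((c • X) i).adjoint =
      (c * (starRingEnd ℂ) c) • ∑ i, X i ∘L (X i).adjoint := by
    rw [Finset.smul_sum]
    refine Finset.sum_congr rfl fun i _ => ?_
    rw [Pi.smul_apply, map_smulₛₗ, ContinuousLinearMap.smul_comp, ContinuousLinearMap.comp_smul,
      smul_smul]
  rw [rowNorm, h, norm_smul, norm_mul, RCLike.norm_conj, Real.sqrt_mul (by positivity),
    Real.sqrt_mul_self (norm_nonneg _), rowNorm]

theorem sum_norm_adjoint_sq_le (X : Fin n → K →L[ℂ] K) (y : K) :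
    ∑ i, ‖(X i).adjoint y‖ ^ 2 ≤ rowNorm X ^ 2 * ‖y‖ ^ 2 := by
  rw [rowNorm_sq]
  simpa only [ContinuousLinearMap.adjoint_adjoint] using
    sum_norm_sq_le (fun i => (X i).adjoint) y

/-- Peel off the first letter: `X_{iα}* = X_α* X_i*`, so the inductive bound is used at the vectors
`X_i* y`, whose squared norms sum to at most `rowNorm X ^ 2 * ‖y‖ ^ 2`. -/
theorem sum_norm_adjoint_word_sq_le (X : Fin n → K →L[ℂ] K) (k : ℕ) (y : K) :
    ∑ w : Fin k → Fin n, ‖(FreeMonoid.lift X (word w)).adjoint y‖ ^ 2 ≤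
      (rowNorm X ^ k) ^ 2 * ‖y‖ ^ 2 := by
  induction k generalizing y with
  | zero => simp [word_zero, ContinuousLinearMap.one_def, ContinuousLinearMap.adjoint_id]
  | succ k ih =>
    rw [sum_words_succ]
    calc ∑ i, ∑ w : Fin k → Fin n,
          ‖(FreeMonoid.lift X (word (Fin.cons i w : Fin (k + 1) → Fin n))).adjoint y‖ ^ 2
        = ∑ i, ∑ w : Fin k → Fin n,
          ‖(FreeMonoid.lift X (word w)).adjoint ((X i).adjoint y)‖ ^ 2 := by
          refine Finset.sum_congr rfl fun i _ => Finset.sum_congr rfl fun w _ => ?_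
          rw [word_cons, map_mul, FreeMonoid.lift_eval_of, ContinuousLinearMap.mul_def,
            ContinuousLinearMap.adjoint_comp, ContinuousLinearMap.comp_apply]
      _ ≤ ∑ i, (rowNorm X ^ k) ^ 2 * ‖(X i).adjoint y‖ ^ 2 :=
          Finset.sum_le_sum fun i _ => ih _
      _ = (rowNorm X ^ k) ^ 2 * ∑ i, ‖(X i).adjoint y‖ ^ 2 := by rw [Finset.mul_sum]
      _ ≤ (rowNorm X ^ k) ^ 2 * (rowNorm X ^ 2 * ‖y‖ ^ 2) :=
          mul_le_mul_of_nonneg_left (sum_norm_adjoint_sq_le X y) (by positivity)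
      _ = _ := by ring

theorem norm_sum_words_le (X : Fin n → K →L[ℂ] K) (k : ℕ) :
    ‖∑ w : Fin k → Fin n, FreeMonoid.lift X (word w) ∘L (FreeMonoid.lift X (word w)).adjoint‖ ≤
      (rowNorm X ^ k) ^ 2 := by
  have := norm_sum_adjoint_comp_le
    (fun w : Fin k → Fin n => (FreeMonoid.lift X (word w)).adjoint) (by positivity)
    (sum_norm_adjoint_word_sq_le X k)
  simpa only [ContinuousLinearMap.adjoint_adjoint] using this

theorem norm_apply_le_rowNorm (X : Fin n → K →L[ℂ] K) (i : Fin n) : ‖X i‖ ≤ rowNorm X := by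
  rw [← LinearIsometryEquiv.norm_map ContinuousLinearMap.adjoint (X i)]
  refine ContinuousLinearMap.opNorm_le_bound _ (rowNorm_nonneg X) fun y => ?_
  refine abs_le_of_sq_le_sq' ?_ (by have := rowNorm_nonneg X; positivity) |>.2
  rw [mul_pow]
  exact (Finset.single_le_sum (f := fun i => ‖(X i).adjoint y‖ ^ 2)
    (fun _ _ => by positivity) (Finset.mem_univ i)).trans (sum_norm_adjoint_sq_le X y)

omit [CompleteSpace K] in
theorem lift_smul_word (c : ℂ) (X : Fin n → K →L[ℂ] K) {k : ℕ} (w : Fin k → Fin n) :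
    FreeMonoid.lift (c • X) (word w) = c ^ k • FreeMonoid.lift X (word w) := by
  induction k with
  | zero => simp [word_zero]
  | succ k ih =>
    rw [← Fin.cons_self_tail w, word_cons, map_mul, map_mul, ih, FreeMonoid.lift_eval_of,
      FreeMonoid.lift_eval_of, Pi.smul_apply, smul_mul_smul_comm, pow_succ']

/-- The point `rX` of the open ball, for `0 ≤ r < 1` and `X` in the closed ball. -/
def dilate (r : Set.Ico (0 : ℝ) 1) (X : Fin n → K →L[ℂ] K) (hX : rowNorm X ≤ 1) : OpenBall n K :=
  ⟨((r : ℝ) : ℂ) • X, by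
    rw [rowNorm_smul, Complex.norm_real, Real.norm_of_nonneg r.2.1]
    nlinarith [r.2.1, r.2.2, rowNorm_nonneg X]⟩

end Words

/-! ### Growth of coefficients -/

section Growth

variable {n : ℕ} {E : Type*} [NormedAddCommGroup E] [InnerProductSpace ℂ E] [CompleteSpace E]

/-- The norm of the column of the coefficients of degree `k`. -/
def columnNorm (A : FreeMonoid (Fin n) → E →L[ℂ] E) (k : ℕ) : ℝ :=
  Real.sqrt ‖∑ w : Fin k → Fin n, (A (word w)).adjoint ∘L A (word w)‖

theorem columnNorm_nonneg (A : FreeMonoid (Fin n) → E →L[ℂ] E) (k : ℕ) : 0 ≤ columnNorm A k :=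
  Real.sqrt_nonneg _

theorem sum_norm_sq_le_columnNorm (A : FreeMonoid (Fin n) → E →L[ℂ] E) (k : ℕ) (x : E) :
    ∑ w : Fin k → Fin n, ‖A (word w) x‖ ^ 2 ≤ columnNorm A k ^ 2 * ‖x‖ ^ 2 := by
  rw [columnNorm, Real.sq_sqrt (norm_nonneg _)]
  exact sum_norm_sq_le (fun w : Fin k → Fin n => A (word w)) x

theorem columnNorm_le {A : FreeMonoid (Fin n) → E →L[ℂ] E} {k : ℕ} {c : ℝ} (hc : 0 ≤ c)
    (h : ∀ x, ∑ w : Fin k → Fin n, ‖A (word w) x‖ ^ 2 ≤ c ^ 2 * ‖x‖ ^ 2) : columnNorm A k ≤ c :=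
  Real.sqrt_le_iff.2 ⟨hc, norm_sum_adjoint_comp_le (fun w : Fin k → Fin n => A (word w))
    (by positivity) h⟩

theorem columnNorm_smul_le (c : ℂ) (A : FreeMonoid (Fin n) → E →L[ℂ] E) (k : ℕ) :
    columnNorm (c • A) k ≤ ‖c‖ * columnNorm A k := by
  refine columnNorm_le (mul_nonneg (norm_nonneg _) (columnNorm_nonneg _ _)) fun x => ?_
  have := mul_le_mul_of_nonneg_left (sum_norm_sq_le_columnNorm A k x) (sq_nonneg ‖c‖)
  simp only [Pi.smul_apply, smul_apply, norm_smul, mul_pow]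
  rw [← Finset.mul_sum]
  linarith

/-- The constant 2 is not sharp; only the exponential growth rate in `k` matters for the radius of
convergence. -/
theorem columnNorm_add_le (A B : FreeMonoid (Fin n) → E →L[ℂ] E) (k : ℕ) :
    columnNorm (A + B) k ≤ 2 * (columnNorm A k + columnNorm B k) := by
  have hA := columnNorm_nonneg A k
  have hB := columnNorm_nonneg B k
  refine columnNorm_le (by positivity) fun x => ?_
  have h : ∀ w : Fin k → Fin n, ‖(A + B) (word w) x‖ ^ 2 ≤
      2 * ‖A (word w) x‖ ^ 2 + 2 * ‖B (word w) x‖ ^ 2 := fun w => by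
    have := norm_add_le (A (word w) x) (B (word w) x)
    rw [Pi.add_apply, add_apply]
    nlinarith [norm_nonneg (A (word w) x + B (word w) x),
      sq_nonneg (‖A (word w) x‖ - ‖B (word w) x‖)]
  refine (Finset.sum_le_sum fun w _ => h w).trans ?_
  rw [Finset.sum_add_distrib, ← Finset.mul_sum, ← Finset.mul_sum]
  have h1 := sum_norm_sq_le_columnNorm A k x
  have h2 := sum_norm_sq_le_columnNorm B k x
  nlinarith [sq_nonneg ‖x‖, mul_nonneg (mul_nonneg hA hB) (sq_nonneg ‖x‖),
    mul_nonneg (sq_nonneg (columnNorm A k)) (sq_nonneg ‖x‖),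
    mul_nonneg (sq_nonneg (columnNorm B k)) (sq_nonneg ‖x‖)]

theorem enorm_sum_eq_ofReal_columnNorm (A : FreeMonoid (Fin n) → E →L[ℂ] E) (k : ℕ) :
    ‖∑ w : Fin k → Fin n, (A (word w)).adjoint ∘L A (word w)‖ₑ =
      ENNReal.ofReal (columnNorm A k ^ 2) := by
  rw [columnNorm, Real.sq_sqrt (norm_nonneg _), ofReal_norm]

/-- Removes the fractional power from the limsup. The case `k = 0` is excluded because there the
exponent `1 / 0` is read as `0`, and the left side would say `1 ≤ t`. -/
theorem enorm_rpow_le_iff {A : FreeMonoid (Fin n) → E →L[ℂ] E} {k : ℕ} (hk : 0 < k) {t : ℝ}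
    (ht : 0 ≤ t) :
    ‖∑ w : Fin k → Fin n, (A (word w)).adjoint ∘L A (word w)‖ₑ ^ (1 / (2 * k : ℝ)) ≤
      ENNReal.ofReal t ↔ columnNorm A k ≤ t ^ k := by
  have hk' : (0 : ℝ) < 2 * k := by positivity
  rw [enorm_sum_eq_ofReal_columnNorm, one_div, ENNReal.rpow_inv_le_iff hk',
    ENNReal.ofReal_rpow_of_nonneg ht hk'.le, ENNReal.ofReal_le_ofReal_iff (by positivity)]
  have h : t ^ (2 * k : ℝ) = (t ^ k) ^ 2 := by
    rw [← pow_mul, ← Real.rpow_natCast]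
    push_cast
    ring_nf
  rw [h, sq_le_sq₀ (columnNorm_nonneg _ _) (by positivity)]

theorem summable_columnNorm {A : FreeMonoid (Fin n) → E →L[ℂ] E} (hA : 1 ≤ radiusOfConvergence A)
    {ρ : ℝ} (h0 : 0 ≤ ρ) (h1 : ρ < 1) : Summable fun k => columnNorm A k * ρ ^ k := by
  -- Root test: since the limsup is at most `1 < t`, eventually `columnNorm A k ≤ t ^ k`, and the
  -- series is dominated by the geometric series of ratio `t * ρ`. For `ρ = 0` any `t > 1` works.
  obtain ⟨t, ht1, ht2⟩ : ∃ t : ℝ, 1 < t ∧ t * ρ < 1 := by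
    rcases h0.eq_or_lt with rfl | h0
    · exact ⟨2, by norm_num, by norm_num⟩
    · obtain ⟨t, h2, h3⟩ := exists_between ((one_lt_inv₀ h0).2 h1)
      exact ⟨t, h2, by rwa [lt_inv_comm₀ (by positivity) h0, ← one_div, lt_div_iff₀ (by positivity),
        mul_comm] at h3⟩
  rw [radiusOfConvergence, ENNReal.one_le_inv] at hA
  have hlt := Filter.eventually_lt_of_limsup_lt
    (hA.trans_lt (ENNReal.one_lt_ofReal.2 ht1))
  refine Summable.of_norm_bounded_eventually_nat
    (summable_geometric_of_lt_one (by positivity) ht2) ?_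
  filter_upwards [hlt, Filter.eventually_gt_atTop 0] with k hk hk0
  have h4 := (enorm_rpow_le_iff hk0 (by positivity)).1 hk.le
  rw [norm_mul, Real.norm_of_nonneg (columnNorm_nonneg A k), norm_pow, Real.norm_of_nonneg h0,
    mul_pow]
  gcongr

theorem exists_columnNorm_le {A : FreeMonoid (Fin n) → E →L[ℂ] E} (hA : 1 ≤ radiusOfConvergence A)
    {t : ℝ} (ht : 1 < t) : ∃ C, 0 ≤ C ∧ ∀ k, columnNorm A k ≤ C * t ^ k := by
  have hs := summable_columnNorm hA (inv_nonneg.2 (zero_le_one.trans ht.le)) (inv_lt_one_of_one_lt₀ ht)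
  have hpos : ∀ k, 0 ≤ columnNorm A k * t⁻¹ ^ k := fun k =>
    mul_nonneg (columnNorm_nonneg A k) (by positivity)
  -- The constant is the whole sum at radius `t⁻¹ < 1`, which bounds each of its nonnegative terms.
  refine ⟨∑' k, columnNorm A k * t⁻¹ ^ k, tsum_nonneg hpos, fun k => ?_⟩
  have h := hs.le_tsum k fun j _ => hpos j
  rw [inv_pow, ← div_eq_mul_inv, div_le_iff₀ (by positivity)] at h
  simpa only [inv_pow, div_eq_mul_inv] using h

/-- Given a threshold `b > 1`, take `s` with `1 < s < b`: the bound `C * s ^ k` falls below `b ^ k`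
once `(b / s) ^ k ≥ C`. With `exists_columnNorm_le` this describes radius at least one by growth
below every `t ^ k`, a condition visibly stable under linear combinations. -/
theorem one_le_radiusOfConvergence {A : FreeMonoid (Fin n) → E →L[ℂ] E}
    (h : ∀ t : ℝ, 1 < t → ∃ C, ∀ k, columnNorm A k ≤ C * t ^ k) : 1 ≤ radiusOfConvergence A := by
  rw [radiusOfConvergence, ENNReal.one_le_inv]
  refine le_of_forall_gt_imp_ge_of_dense fun b hb => ?_
  rcases eq_or_ne b ⊤ with rfl | hb'
  · exact le_top
  lift b to NNReal using hb'
  have hb1 : (1 : ℝ) < b := by exact_mod_cast hb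
  obtain ⟨s, hs1, hs2⟩ := exists_between hb1
  obtain ⟨C, hC⟩ := h s hs1
  have hs0 : 0 < s := zero_lt_one.trans hs1
  refine Filter.limsup_le_of_le (by isBoundedDefault) ?_
  have hlim := tendsto_pow_atTop_atTop_of_one_lt ((one_lt_div hs0).2 hs2)
  filter_upwards [hlim.eventually_ge_atTop C, Filter.eventually_gt_atTop 0] with k hk hk0
  rw [← ENNReal.ofReal_coe_nnreal]
  refine (enorm_rpow_le_iff hk0 b.2).2 ((hC k).trans ?_)
  rwa [div_pow, le_div_iff₀ (by positivity)] at hk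

theorem one_le_radiusOfConvergence_add {A B : FreeMonoid (Fin n) → E →L[ℂ] E}
    (hA : 1 ≤ radiusOfConvergence A) (hB : 1 ≤ radiusOfConvergence B) :
    1 ≤ radiusOfConvergence (A + B) := by
  refine one_le_radiusOfConvergence fun t ht => ?_
  obtain ⟨C, -, hC⟩ := exists_columnNorm_le hA ht
  obtain ⟨D, -, hD⟩ := exists_columnNorm_le hB ht
  refine ⟨2 * (C + D), fun k => (columnNorm_add_le A B k).trans ?_⟩
  linarith [hC k, hD k]

theorem one_le_radiusOfConvergence_smul {A : FreeMonoid (Fin n) → E →L[ℂ] E} (c : ℂ)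
    (hA : 1 ≤ radiusOfConvergence A) : 1 ≤ radiusOfConvergence (c • A) := by
  refine one_le_radiusOfConvergence fun t ht => ?_
  obtain ⟨C, -, hC⟩ := exists_columnNorm_le hA ht
  refine ⟨‖c‖ * C, fun k => (columnNorm_smul_le c A k).trans ?_⟩
  rw [mul_assoc]
  exact mul_le_mul_of_nonneg_left (hC k) (norm_nonneg c)

end Growth

/-! ### Free holomorphic functions as sums of power series -/

theorem hasSum_of_summable_norm {V W : Type*} [NormedAddCommGroup V] [NormedSpace ℂ V]
    [NormedAddCommGroup W] [NormedSpace ℂ W] [CompleteSpace W] {f : ℕ → V →L[ℂ] W}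
    (hf : Summable fun k => ‖f k‖) : HasSum f (∑' k, f k) :=
  hf.of_norm.hasSum

/-- Dominated convergence, each term being bounded by `‖f k‖` because `0 ≤ r < 1`. -/
theorem tendsto_tsum_pow_smul {V W : Type*} [NormedAddCommGroup V] [NormedSpace ℂ V]
    [NormedAddCommGroup W] [NormedSpace ℂ W] [CompleteSpace W] {f : ℕ → V →L[ℂ] W}
    (hf : Summable fun k => ‖f k‖) :
    Filter.Tendsto (fun r : Set.Ico (0 : ℝ) 1 => ∑' k, ((r : ℝ) : ℂ) ^ k • f k)
      (Filter.comap Subtype.val (𝓝 1)) (𝓝 (∑' k, f k)) := by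
  refine tendsto_tsum_of_dominated_convergence hf
    (fun k => ?_) (Filter.Eventually.of_forall fun r k => ?_)
  · have h : Filter.Tendsto (fun r : Set.Ico (0 : ℝ) 1 => ((r : ℝ) : ℂ) ^ k)
        (Filter.comap Subtype.val (𝓝 1)) (𝓝 (((1 : ℝ) : ℂ) ^ k)) :=
      (((Complex.continuous_ofReal.tendsto 1).comp Filter.tendsto_comap).pow k)
    simpa using h.smul_const (f k)
  · rw [norm_smul, norm_pow, Complex.norm_real, Real.norm_of_nonneg r.2.1]
    exact mul_le_of_le_one_left (norm_nonneg _) (pow_le_one₀ r.2.1 r.2.2.le)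

section PowerSeries

variable {n : ℕ} {E K : Type*}
  [NormedAddCommGroup E] [InnerProductSpace ℂ E] [CompleteSpace E]
  [NormedAddCommGroup K] [InnerProductSpace ℂ K] [CompleteSpace K]

/-- Factor `A_α ⊗ X_α = (I ⊗ X_α)(A_α ⊗ I)`, a row times a column: the column has norm at most
`columnNorm A k`, and the row of words of length `k` has norm at most `rowNorm X ^ k`. -/
theorem norm_homogeneousPart_le (A : FreeMonoid (Fin n) → E →L[ℂ] E) (X : Fin n → K →L[ℂ] K)
    (k : ℕ) : ‖homogeneousPart A X k‖ ≤ columnNorm A k * rowNorm X ^ k := by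
  have h1 : homogeneousPart A X k = ∑ w : Fin k → Fin n,
      opTensor (ContinuousLinearMap.id ℂ E) (FreeMonoid.lift X (word w)) ∘L
        opTensor (A (word w)) (ContinuousLinearMap.id ℂ K) := by
    refine Finset.sum_congr rfl fun w _ => ?_
    rw [← opTensor_comp]
    rfl
  have h2 : ‖∑ w : Fin k → Fin n,
      (opTensor (A (word w)) (ContinuousLinearMap.id ℂ K)).adjoint ∘L
        opTensor (A (word w)) (ContinuousLinearMap.id ℂ K)‖ ≤ columnNorm A k ^ 2 := by
    have : ∑ w : Fin k → Fin n, (opTensor (A (word w)) (ContinuousLinearMap.id ℂ K)).adjoint ∘L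
        opTensor (A (word w)) (ContinuousLinearMap.id ℂ K) =
        opTensor (∑ w : Fin k → Fin n, (A (word w)).adjoint ∘L A (word w))
          (ContinuousLinearMap.id ℂ K) := by
      rw [← opTensorR_apply, map_sum]
      refine Finset.sum_congr rfl fun w _ => ?_
      rw [adjoint_opTensor, ← opTensor_comp, opTensorR_apply, ContinuousLinearMap.adjoint_id]
      rfl
    rw [this, columnNorm, Real.sq_sqrt (norm_nonneg _)]
    exact (norm_opTensor_le _ _).trans
      (mul_le_of_le_one_right (norm_nonneg _) ContinuousLinearMap.norm_id_le)
  have h3 : ‖∑ w : Fin k → Fin n,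
      opTensor (ContinuousLinearMap.id ℂ E) (FreeMonoid.lift X (word w)) ∘L
        (opTensor (ContinuousLinearMap.id ℂ E) (FreeMonoid.lift X (word w))).adjoint‖ ≤
      (rowNorm X ^ k) ^ 2 := by
    have : ∑ w : Fin k → Fin n,
        opTensor (ContinuousLinearMap.id ℂ E) (FreeMonoid.lift X (word w)) ∘L
          (opTensor (ContinuousLinearMap.id ℂ E) (FreeMonoid.lift X (word w))).adjoint =
        opTensor (ContinuousLinearMap.id ℂ E) (∑ w : Fin k → Fin n,
          FreeMonoid.lift X (word w) ∘L (FreeMonoid.lift X (word w)).adjoint) := by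
      rw [← opTensorL_apply, map_sum]
      refine Finset.sum_congr rfl fun w _ => ?_
      rw [adjoint_opTensor, ← opTensor_comp, opTensorL_apply, ContinuousLinearMap.adjoint_id]
      rfl
    rw [this]
    refine (norm_opTensor_le _ _).trans ((mul_le_of_le_one_left (norm_nonneg _)
      ContinuousLinearMap.norm_id_le).trans (norm_sum_words_le X k))
  rw [h1]
  refine (norm_sum_comp_le _ _).trans ?_
  rw [mul_comm]
  have hr := rowNorm_nonneg X
  exact mul_le_mul (Real.sqrt_le_iff.2 ⟨columnNorm_nonneg A k, h2⟩)
    (Real.sqrt_le_iff.2 ⟨by positivity, h3⟩) (Real.sqrt_nonneg _) (columnNorm_nonneg A k)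

omit [CompleteSpace E] [CompleteSpace K] in
theorem homogeneousPart_add (A B : FreeMonoid (Fin n) → E →L[ℂ] E) (X : Fin n → K →L[ℂ] K)
    (k : ℕ) : homogeneousPart (A + B) X k = homogeneousPart A X k + homogeneousPart B X k := by
  simp only [homogeneousPart, Pi.add_apply, opTensor_add_left, Finset.sum_add_distrib]

omit [CompleteSpace E] [CompleteSpace K] in
theorem homogeneousPart_smul (c : ℂ) (A : FreeMonoid (Fin n) → E →L[ℂ] E) (X : Fin n → K →L[ℂ] K)
    (k : ℕ) : homogeneousPart (c • A) X k = c • homogeneousPart A X k := by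
  simp only [homogeneousPart, Pi.smul_apply, opTensor_smul_left, Finset.smul_sum]

omit [CompleteSpace E] [CompleteSpace K] in
theorem homogeneousPart_smul_point (c : ℂ) (A : FreeMonoid (Fin n) → E →L[ℂ] E)
    (X : Fin n → K →L[ℂ] K) (k : ℕ) :
    homogeneousPart A (c • X) k = c ^ k • homogeneousPart A X k := by
  simp only [homogeneousPart, lift_smul_word, opTensor_smul_right, Finset.smul_sum]

omit [CompleteSpace E] [CompleteSpace K] in
theorem homogeneousPart_mem (A : FreeMonoid (Fin n) → E →L[ℂ] E) (X : Fin n → K →L[ℂ] K) (k : ℕ) :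
    homogeneousPart A X k ∈ minTensor (⊤ : Submodule ℂ (E →L[ℂ] E)) (⊤ : Submodule ℂ (K →L[ℂ] K)) :=
  Submodule.sum_mem _ fun _ _ => opTensor_mem_minTensor trivial trivial

/-- The sum `∑ₖ ∑_{|α| = k} A_α ⊗ X_α`. -/
def powerSum (A : FreeMonoid (Fin n) → E →L[ℂ] E) (X : Fin n → K →L[ℂ] K) :
    HilbertTensor E K →L[ℂ] HilbertTensor E K :=
  ∑' k, homogeneousPart A X k

variable {A B : FreeMonoid (Fin n) → E →L[ℂ] E} {X : Fin n → K →L[ℂ] K}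

theorem summable_norm_homogeneousPart (hA : 1 ≤ radiusOfConvergence A) (hX : rowNorm X < 1) :
    Summable fun k => ‖homogeneousPart A X k‖ :=
  Summable.of_nonneg_of_le (fun k => ContinuousLinearMap.opNorm_nonneg (homogeneousPart A X k))
    (norm_homogeneousPart_le A X) (summable_columnNorm hA (rowNorm_nonneg X) hX)

theorem hasSum_powerSum (hA : 1 ≤ radiusOfConvergence A) (hX : rowNorm X < 1) :
    HasSum (homogeneousPart A X) (powerSum A X) :=
  hasSum_of_summable_norm (summable_norm_homogeneousPart hA hX)

theorem powerSum_mem (hA : 1 ≤ radiusOfConvergence A) (hX : rowNorm X < 1) :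
    powerSum A X ∈ minTensor (⊤ : Submodule ℂ (E →L[ℂ] E)) (⊤ : Submodule ℂ (K →L[ℂ] K)) :=
  (Submodule.isClosed_topologicalClosure _).mem_of_tendsto (hasSum_powerSum hA hX)
    (Filter.Eventually.of_forall fun _ => Submodule.sum_mem _ fun k _ => homogeneousPart_mem A X k)

theorem powerSum_add (hA : 1 ≤ radiusOfConvergence A) (hB : 1 ≤ radiusOfConvergence B)
    (hX : rowNorm X < 1) : powerSum (A + B) X = powerSum A X + powerSum B X := by
  refine HasSum.tsum_eq ?_
  rw [funext (homogeneousPart_add A B X)]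
  exact (hasSum_powerSum hA hX).add (hasSum_powerSum hB hX)

theorem powerSum_smul (c : ℂ) (hA : 1 ≤ radiusOfConvergence A) (hX : rowNorm X < 1) :
    powerSum (c • A) X = c • powerSum A X := by
  refine HasSum.tsum_eq ?_
  rw [funext (homogeneousPart_smul c A X)]
  exact (hasSum_powerSum hA hX).const_smul c

theorem tendsto_powerSum_dilate (hA : 1 ≤ radiusOfConvergence A) (hX : rowNorm X < 1) :
    Filter.Tendsto (fun r : Set.Ico (0 : ℝ) 1 => powerSum A (((r : ℝ) : ℂ) • X))
      (Filter.comap Subtype.val (𝓝 1)) (𝓝 (powerSum A X)) := by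
  have h := tendsto_tsum_pow_smul (summable_norm_homogeneousPart hA hX)
  simpa only [powerSum, homogeneousPart_smul_point] using h

/-! ### Free pluriharmonic functions as sums of two power series -/

/-- Rewrites `Re F₁ + i Re F₂` as an analytic part plus the adjoint of another; the sign flips since
the conjugate of `-i/2` is `i/2`. -/
theorem rePart_combination (S T : K →L[ℂ] K) :
    rePart S + Complex.I • rePart T = ((1 / 2 : ℂ) • S + (Complex.I / 2) • T) +
      ((1 / 2 : ℂ) • S + (-(Complex.I / 2)) • T).adjoint := by
  rw [rePart, rePart, map_add, map_smulₛₗ, map_smulₛₗ]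
  simp only [map_neg, map_div₀, Complex.conj_I, map_one, map_ofNat]
  module

theorem IsFreeHolomorphicWith.eq_powerSum {F : OpenBall n K → MinOp E K}
    (h : IsFreeHolomorphicWith A F) (X : OpenBall n K) : (F X).1 = powerSum A X.1 :=
  (h.2 X).tsum_eq.symm

theorem IsFreePluriharmonicWith.eq_powerSum {u : OpenBall n K → MinOp E K}
    (h : IsFreePluriharmonicWith A B u) (X : OpenBall n K) :
    (u X).1 = powerSum ((1 / 2 : ℂ) • A + (Complex.I / 2) • B) X.1 +
      (powerSum ((1 / 2 : ℂ) • A + (-(Complex.I / 2)) • B) X.1).adjoint := by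
  obtain ⟨F₁, F₂, h₁, h₂, h⟩ := h
  have hs := fun (c : ℂ) => one_le_radiusOfConvergence_smul c h₁.1
  have ht := fun (c : ℂ) => one_le_radiusOfConvergence_smul c h₂.1
  rw [h, h₁.eq_powerSum, h₂.eq_powerSum, rePart_combination, powerSum_add (hs _) (ht _) X.2,
    powerSum_add (hs _) (ht _) X.2, powerSum_smul _ h₁.1 X.2, powerSum_smul _ h₂.1 X.2,
    powerSum_smul _ h₂.1 X.2]

theorem IsFreePluriharmonicWith.radius {u : OpenBall n K → MinOp E K}
    (h : IsFreePluriharmonicWith A B u) :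
    1 ≤ radiusOfConvergence A ∧ 1 ≤ radiusOfConvergence B := by
  obtain ⟨F₁, F₂, h₁, h₂, h⟩ := h
  exact ⟨h₁.1, h₂.1⟩

theorem exists_isFreePluriharmonicWith (hA : 1 ≤ radiusOfConvergence A)
    (hB : 1 ≤ radiusOfConvergence B) :
    ∃ v : OpenBall n K → MinOp E K, IsFreePluriharmonicWith A B v := by
  have hre : ∀ {T : HilbertTensor E K →L[ℂ] HilbertTensor E K},
      T ∈ minTensor (⊤ : Submodule ℂ (E →L[ℂ] E)) (⊤ : Submodule ℂ (K →L[ℂ] K)) →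
      rePart T ∈ minTensor (⊤ : Submodule ℂ (E →L[ℂ] E)) (⊤ : Submodule ℂ (K →L[ℂ] K)) :=
    fun hT => Submodule.smul_mem _ _ (add_mem hT (minTensor_top_adjoint hT))
  exact ⟨fun X => ⟨rePart (powerSum A X.1) + Complex.I • rePart (powerSum B X.1),
      add_mem (hre (powerSum_mem hA X.2)) (Submodule.smul_mem _ _ (hre (powerSum_mem hB X.2)))⟩,
    fun X => ⟨_, powerSum_mem hA X.2⟩, fun X => ⟨_, powerSum_mem hB X.2⟩,
    ⟨hA, fun X => hasSum_powerSum hA X.2⟩, ⟨hB, fun X => hasSum_powerSum hB X.2⟩, fun X => rfl⟩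

/-- Inverts `IsFreePluriharmonicWith.eq_powerSum`: solving `A = ½A₁ + (i/2)A₂`, `B = ½A₁ - (i/2)A₂`
gives `A₁ = A + B` and `A₂ = -i(A - B)`. -/
theorem isFreePluriharmonicWith_of_eq {u : OpenBall n K → MinOp E K}
    (hA : 1 ≤ radiusOfConvergence A) (hB : 1 ≤ radiusOfConvergence B)
    (h : ∀ X, (u X).1 = powerSum A X.1 + (powerSum B X.1).adjoint) :
    IsFreePluriharmonicWith (A + B) ((-Complex.I) • A + Complex.I • B) u := by
  have h₁ := one_le_radiusOfConvergence_add hA hB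
  have h₂ := one_le_radiusOfConvergence_add (one_le_radiusOfConvergence_smul (-Complex.I) hA)
    (one_le_radiusOfConvergence_smul Complex.I hB)
  obtain ⟨v, hv⟩ := exists_isFreePluriharmonicWith (K := K) h₁ h₂
  have huv : u = v := by
    funext X
    refine Subtype.ext ?_
    rw [h, hv.eq_powerSum]
    have e1 : (1 / 2 : ℂ) • (A + B) + (Complex.I / 2) • ((-Complex.I) • A + Complex.I • B) = A := by
      have hI : Complex.I / 2 * Complex.I = -(1 / 2) := by
        linear_combination (1 / 2 : ℂ) * Complex.I_mul_I
      rw [smul_add, smul_add, smul_smul, smul_smul, mul_neg, hI]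
      module
    have e2 : (1 / 2 : ℂ) • (A + B) + (-(Complex.I / 2)) • ((-Complex.I) • A + Complex.I • B) =
        B := by
      have hI : Complex.I / 2 * Complex.I = -(1 / 2) := by
        linear_combination (1 / 2 : ℂ) * Complex.I_mul_I
      rw [smul_add, smul_add, smul_smul, smul_smul, neg_mul_neg, neg_mul, hI]
      module
    rw [e1, e2]
  rwa [huv]

end PowerSeries

/-! ### Relations between the creation operators -/

section Creation

variable {n : ℕ}

theorem fock_ext {W : Type*} [NormedAddCommGroup W] [NormedSpace ℂ W] {S T : Fock n →L[ℂ] W}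
    (h : ∀ α, S (fockBasis n α) = T (fockBasis n α)) : S = T := by
  refine ContinuousLinearMap.ext_on
    (Submodule.dense_iff_topologicalClosure_eq_top.mpr (fockBasis n).dense_span) ?_
  rintro _ ⟨α, rfl⟩
  exact h α

theorem fock_eq_of_inner {x y : Fock n}
    (h : ∀ α, inner ℂ (fockBasis n α) x = inner ℂ (fockBasis n α) y) : x = y := by
  refine (fockBasis n).repr.injective (lp.ext (funext fun β => ?_))
  rw [HilbertBasis.repr_apply_apply, HilbertBasis.repr_apply_apply, h]

theorem inner_fockBasis (α β : FreeMonoid (Fin n)) [Decidable (α = β)] :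
    inner ℂ (fockBasis n α) (fockBasis n β) = if α = β then (1 : ℂ) else 0 := by
  classical
  rw [orthonormal_iff_ite.mp (fockBasis n).orthonormal]
  congr

theorem adjoint_leftCreation_vacuum (i : Fin n) :
    (leftCreation i).adjoint (fockBasis n 1) = 0 := by
  classical
  refine fock_eq_of_inner fun α => ?_
  rw [ContinuousLinearMap.adjoint_inner_right, leftCreation_fockBasis, inner_fockBasis,
    inner_zero_right, if_neg]
  exact fun h => List.cons_ne_nil _ _ (congrArg FreeMonoid.toList h)

theorem adjoint_leftCreation_of_mul (i j : Fin n) (α : FreeMonoid (Fin n)) :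
    (leftCreation i).adjoint (fockBasis n (FreeMonoid.of j * α)) =
      if i = j then fockBasis n α else 0 := by
  rw [← leftCreation_fockBasis, ← ContinuousLinearMap.comp_apply, adjoint_leftCreation_comp]
  split_ifs <;> rfl

theorem adjoint_rightCreation_vacuum (i : Fin n) :
    (rightCreation i).adjoint (fockBasis n 1) = 0 := by
  classical
  refine fock_eq_of_inner fun α => ?_
  rw [ContinuousLinearMap.adjoint_inner_right, rightCreation_fockBasis, inner_fockBasis,
    inner_zero_right, if_neg]
  intro h
  have := congrArg FreeMonoid.length h
  simp at this

theorem adjoint_rightCreation_comp (i j : Fin n) :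
    (rightCreation i).adjoint ∘L rightCreation j = if i = j then 1 else 0 := by
  classical
  refine fock_ext fun α => fock_eq_of_inner fun β => ?_
  rw [ContinuousLinearMap.comp_apply, ContinuousLinearMap.adjoint_inner_right,
    rightCreation_fockBasis, rightCreation_fockBasis]
  by_cases h : i = j
  · subst h
    have h2 : β * FreeMonoid.of i = α * FreeMonoid.of i ↔ β = α := mul_left_inj _
    simp [inner_fockBasis, h2]
  · have h2 : ¬ (β * FreeMonoid.of i = α * FreeMonoid.of j) := fun h3 => by
      have h4 := List.append_inj' (congrArg FreeMonoid.toList h3) rfl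
      exact h (List.cons.inj h4.2).1
    rw [inner_fockBasis, if_neg h2, if_neg h]
    simp

/-- The orthogonal projection of the Fock space onto the vacuum vector. -/
def vacuumProj (n : ℕ) : Fock n →L[ℂ] Fock n :=
  (innerSL ℂ (fockBasis n 1)).smulRight (fockBasis n 1)

theorem vacuumProj_apply (x : Fock n) :
    vacuumProj n x = inner ℂ (fockBasis n 1) x • fockBasis n 1 := rfl

theorem vacuumProj_vacuum : vacuumProj n (fockBasis n 1) = fockBasis n 1 := by
  classical
  rw [vacuumProj_apply, inner_fockBasis, if_pos rfl, one_smul]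

theorem vacuumProj_fockBasis_of_ne {α : FreeMonoid (Fin n)} (h : α ≠ 1) :
    vacuumProj n (fockBasis n α) = 0 := by
  classical
  rw [vacuumProj_apply, inner_fockBasis, if_neg h.symm, zero_smul]

theorem vacuumProj_comp_rightCreation (i : Fin n) : vacuumProj n ∘L rightCreation i = 0 := by
  ext1 x
  rw [ContinuousLinearMap.comp_apply, vacuumProj_apply, ← ContinuousLinearMap.adjoint_inner_left,
    adjoint_rightCreation_vacuum, inner_zero_left, zero_smul, zero_apply]

/-- Removing a first letter commutes with appending a last one, except on the vacuum, where the
appended letter is itself the first. This defect term produces the intertwining property of the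
Poisson kernel. -/
theorem adjoint_leftCreation_comp_rightCreation (i j : Fin n) :
    (leftCreation j).adjoint ∘L rightCreation i =
      rightCreation i ∘L (leftCreation j).adjoint + if i = j then vacuumProj n else 0 := by
  refine fock_ext fun α => ?_
  rw [ContinuousLinearMap.comp_apply, rightCreation_fockBasis, add_apply,
    ContinuousLinearMap.comp_apply]
  induction α using FreeMonoid.casesOn with
  | one =>
    have h := adjoint_leftCreation_of_mul j i 1
    rw [mul_one] at h
    rw [one_mul, h, adjoint_leftCreation_vacuum, map_zero, zero_add]
    by_cases hij : i = j
    · rw [if_pos hij, if_pos hij.symm, vacuumProj_vacuum]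
    · rw [if_neg hij, if_neg (Ne.symm hij), zero_apply]
  | of_mul l γ =>
    rw [mul_assoc, adjoint_leftCreation_of_mul, adjoint_leftCreation_of_mul]
    have h0 : (if i = j then vacuumProj n else 0) (fockBasis n (FreeMonoid.of l * γ)) = 0 := by
      split_ifs
      · exact vacuumProj_fockBasis_of_ne fun h =>
          List.cons_ne_nil _ _ (congrArg FreeMonoid.toList h)
      · rfl
    rw [h0, add_zero]
    split_ifs
    · rw [rightCreation_fockBasis]
    · rw [map_zero]

theorem lift_leftCreation_fockBasis (α β : FreeMonoid (Fin n)) :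
    FreeMonoid.lift (leftCreation (n := n)) α (fockBasis n β) = fockBasis n (α * β) := by
  induction α using FreeMonoid.inductionOn' with
  | one => rw [map_one, one_mul]; rfl
  | of_mul i α ih =>
    rw [map_mul, mul_apply_eq_comp, ih, FreeMonoid.lift_eval_of,
      leftCreation_fockBasis, mul_assoc]

theorem rowNorm_leftCreation_le : rowNorm (leftCreation (n := n)) ≤ 1 :=
  Real.sqrt_le_one.2 (norm_sum_leftCreation_le n)

end Creation

theorem isUnit_one_sub_of_norm_lt_one_op {K : Type*} [NormedAddCommGroup K] [InnerProductSpace ℂ K]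
    [CompleteSpace K] {T : K →L[ℂ] K} (hT : ‖T‖ < 1) : IsUnit (1 - T) :=
  isUnit_one_sub_of_norm_lt_one hT

/-- The bounded linear map `T ↦ A T B`. -/
def sandwich {V V' W W' : Type*} [NormedAddCommGroup V] [NormedSpace ℂ V]
    [NormedAddCommGroup V'] [NormedSpace ℂ V'] [NormedAddCommGroup W] [NormedSpace ℂ W]
    [NormedAddCommGroup W'] [NormedSpace ℂ W'] (A : W →L[ℂ] W') (B : V' →L[ℂ] V) :
    (V →L[ℂ] W) →L[ℂ] (V' →L[ℂ] W') :=
  ContinuousLinearMap.compL ℂ V' W W' A ∘L (ContinuousLinearMap.compL ℂ V' V W).flip B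

theorem sandwich_apply {V V' W W' : Type*} [NormedAddCommGroup V] [NormedSpace ℂ V]
    [NormedAddCommGroup V'] [NormedSpace ℂ V'] [NormedAddCommGroup W] [NormedSpace ℂ W]
    [NormedAddCommGroup W'] [NormedSpace ℂ W'] (A : W →L[ℂ] W') (B : V' →L[ℂ] V) (T : V →L[ℂ] W) :
    sandwich A B T = A ∘L T ∘L B := rfl

/-! ### The Poisson kernel is an isometry which intertwines the creation operators -/

section Kernel

variable {n : ℕ} {H : Type*} [NormedAddCommGroup H] [InnerProductSpace ℂ H] [CompleteSpace H]

/-- The operator `R₁ ⊗ X₁* + ⋯ + R_n ⊗ X_n*`. -/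
def reconstruction (X : Fin n → H →L[ℂ] H) : HilbertTensor (Fock n) H →L[ℂ] HilbertTensor (Fock n) H :=
  ∑ i, opTensor (rightCreation i) (X i).adjoint

/-- The right creation operators are isometries with orthogonal ranges, so all cross terms vanish.
This gives both the norm bound making the resolvent exist and the identity behind the isometry of
`K_X`. -/
theorem adjoint_reconstruction_comp (X : Fin n → H →L[ℂ] H) :
    (reconstruction X).adjoint ∘L reconstruction X =
      opTensor (ContinuousLinearMap.id ℂ (Fock n)) (∑ i, X i ∘L (X i).adjoint) := by
  rw [reconstruction, map_sum, ← opTensorL_apply, map_sum]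
  rw [← ContinuousLinearMap.mul_def, Finset.sum_mul]
  refine Finset.sum_congr rfl fun i _ => ?_
  rw [Finset.mul_sum, Finset.sum_eq_single i]
  · rw [ContinuousLinearMap.mul_def, adjoint_opTensor, ← opTensor_comp, adjoint_rightCreation_comp,
      if_pos rfl, ContinuousLinearMap.adjoint_adjoint]
    rfl
  · intro j _ hj
    rw [ContinuousLinearMap.mul_def, adjoint_opTensor, ← opTensor_comp, adjoint_rightCreation_comp,
      if_neg (Ne.symm hj), ← opTensorR_apply, map_zero]
  · simp

variable {X : Fin n → H →L[ℂ] H}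

theorem norm_reconstruction_lt_one (hX : rowNorm X < 1) : ‖reconstruction X‖ < 1 := by
  have h1 : ‖reconstruction X‖ * ‖reconstruction X‖ ≤ rowNorm X ^ 2 := by
    rw [← ContinuousLinearMap.norm_adjoint_comp_self, adjoint_reconstruction_comp, rowNorm_sq]
    exact (norm_opTensor_le _ _).trans
      (mul_le_of_le_one_left (norm_nonneg _) ContinuousLinearMap.norm_id_le)
  nlinarith [rowNorm_nonneg X, norm_nonneg (reconstruction X)]

/-- The vector `(I - ∑ R_i ⊗ X_i*)⁻¹ (1 ⊗ h)`. -/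
def resolventVector (X : Fin n → H →L[ℂ] H) (h : H) : HilbertTensor (Fock n) H :=
  Ring.inverse (1 - reconstruction X) (htmul (fockBasis n 1) h)

theorem ncPoissonKernel_apply (h : H) : ncPoissonKernel X h =
    opTensor (ContinuousLinearMap.id ℂ (Fock n)) (defect X) (resolventVector X h) := rfl

theorem isUnit_one_sub_reconstruction (hX : rowNorm X < 1) : IsUnit (1 - reconstruction X) :=
  isUnit_one_sub_of_norm_lt_one_op (norm_reconstruction_lt_one hX)

/-- Fixed point form of the resolvent; it replaces the Neumann series in the arguments about `K_X`.
-/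
theorem resolventVector_eq_iff (hX : rowNorm X < 1) {h : H} {ξ : HilbertTensor (Fock n) H} :
    ξ = resolventVector X h ↔ ξ = reconstruction X ξ + htmul (fockBasis n 1) h := by
  have hu := isUnit_one_sub_reconstruction hX
  constructor
  · rintro rfl
    have h1 := DFunLike.congr_fun (Ring.mul_inverse_cancel _ hu) (htmul (fockBasis n 1) h)
    rw [mul_apply_eq_comp, sub_apply] at h1
    exact sub_eq_iff_eq_add'.1 h1
  · intro h1
    have h2 : (1 - reconstruction X) ξ = htmul (fockBasis n 1) h := sub_eq_iff_eq_add'.2 h1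
    rw [resolventVector, ← h2, ← mul_apply_eq_comp, Ring.inverse_mul_cancel _ hu]
    rfl

/-- In the fixed point equation the term `reconstruction X ξ` has no vacuum component, since every
`R_i` has range orthogonal to the vacuum. -/
theorem vacuumProj_resolventVector (hX : rowNorm X < 1) (h : H) :
    opTensor (vacuumProj n) (ContinuousLinearMap.id ℂ H) (resolventVector X h) =
      htmul (fockBasis n 1) h := by
  have h1 : opTensor (vacuumProj n) (ContinuousLinearMap.id ℂ H) ∘L reconstruction X = 0 := by
    rw [reconstruction, ContinuousLinearMap.comp_finsetSum]
    refine Finset.sum_eq_zero fun i _ => ?_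
    rw [← opTensor_comp, vacuumProj_comp_rightCreation, ← opTensorR_apply, map_zero]
  rw [(resolventVector_eq_iff hX).1 rfl, map_add, ← ContinuousLinearMap.comp_apply, h1,
    opTensor_htmul, vacuumProj_vacuum, zero_apply, zero_add]
  rfl

/-- Apply `S_j* ⊗ I` to the fixed point equation for `h`. The vacuum term dies, and the commutation
defect contributes `1 ⊗ X_j* h`, so the result satisfies the fixed point equation for `X_j* h`. -/
theorem adjoint_leftCreation_resolventVector (hX : rowNorm X < 1) (j : Fin n) (h : H) :
    opTensor (leftCreation j).adjoint (ContinuousLinearMap.id ℂ H) (resolventVector X h) =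
      resolventVector X ((X j).adjoint h) := by
  rw [resolventVector_eq_iff hX]
  have h1 : opTensor (leftCreation j).adjoint (ContinuousLinearMap.id ℂ H) ∘L reconstruction X =
      reconstruction X ∘L opTensor (leftCreation j).adjoint (ContinuousLinearMap.id ℂ H) +
        opTensor (ContinuousLinearMap.id ℂ _) (X j).adjoint ∘L
          opTensor (vacuumProj n) (ContinuousLinearMap.id ℂ H) := by
    have h2 : ∀ i, opTensor (leftCreation j).adjoint (ContinuousLinearMap.id ℂ H) ∘L
        opTensor (rightCreation i) (X i).adjoint =
        opTensor (rightCreation i) (X i).adjoint ∘L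
          opTensor (leftCreation j).adjoint (ContinuousLinearMap.id ℂ H) +
        if i = j then opTensor (vacuumProj n) (X j).adjoint else 0 := fun i => by
      rw [← opTensor_comp, adjoint_leftCreation_comp_rightCreation, opTensor_add_left,
        ← opTensor_comp]
      congr 1
      split_ifs with hij
      · rw [hij]; rfl
      · rw [← opTensorR_apply, map_zero]
    rw [reconstruction, ContinuousLinearMap.comp_finsetSum, Finset.sum_congr rfl fun i _ => h2 i,
      Finset.sum_add_distrib, ContinuousLinearMap.finsetSum_comp, Finset.sum_ite_eq',
      if_pos (Finset.mem_univ _), ← opTensor_comp]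
    rfl
  have h3 := congrArg (opTensor (leftCreation j).adjoint (ContinuousLinearMap.id ℂ H))
    ((resolventVector_eq_iff hX (h := h)).1 rfl)
  rw [map_add, opTensor_htmul, adjoint_leftCreation_vacuum, ← ContinuousLinearMap.comp_apply, h1,
    add_apply, ContinuousLinearMap.comp_apply, ContinuousLinearMap.comp_apply,
    vacuumProj_resolventVector hX, opTensor_htmul] at h3
  have h4 : htmul (0 : Fock n) (ContinuousLinearMap.id ℂ H h) = 0 := map_zero (htmulRight _ _)
  rw [h4, add_zero] at h3
  exact h3

theorem adjoint_leftCreation_ncPoissonKernel (hX : rowNorm X < 1) (j : Fin n) :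
    opTensor (leftCreation j).adjoint (ContinuousLinearMap.id ℂ H) ∘L ncPoissonKernel X =
      ncPoissonKernel X ∘L (X j).adjoint := by
  ext1 h
  rw [ContinuousLinearMap.comp_apply, ContinuousLinearMap.comp_apply, ncPoissonKernel_apply,
    ncPoissonKernel_apply, ← adjoint_leftCreation_resolventVector hX,
    ← ContinuousLinearMap.comp_apply, ← ContinuousLinearMap.comp_apply, ← opTensor_comp,
    ← opTensor_comp]
  rfl

theorem adjoint_defect_comp_defect (hX : rowNorm X < 1) :
    (defect X).adjoint ∘L defect X = 1 - ∑ i, X i ∘L (X i).adjoint := by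
  have h0 : 0 ≤ 1 - ∑ i, X i ∘L (X i).adjoint := by
    have h1 : 0 ≤ ∑ i, X i ∘L (X i).adjoint := Finset.sum_nonneg fun i _ => mul_star_self_nonneg (X i)
    refine sub_nonneg.2 ((CStarAlgebra.norm_le_one_iff_of_nonneg _ h1).1 ?_)
    rw [← rowNorm_sq]
    exact pow_le_one₀ (rowNorm_nonneg X) hX.le
  have hs : (defect X).adjoint = defect X :=
    (IsSelfAdjoint.of_nonneg (CFC.sqrt_nonneg _)).star_eq
  rw [hs]
  exact CFC.sqrt_mul_sqrt_self _ h0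

/-- Let `g` be the resolvent vector and `R` the reconstruction operator. As `I ⊗ Δ_X² = I - R* R`,
the squared norm is `‖g‖² - ‖R g‖²`; now insert `R g = g - 1 ⊗ h` and `⟨g, 1 ⊗ h⟩ = ‖h‖²`. -/
theorem norm_ncPoissonKernel_apply (hX : rowNorm X < 1) (h : H) : ‖ncPoissonKernel X h‖ = ‖h‖ := by
  set g := resolventVector X h with hg
  have h1 : (opTensor (ContinuousLinearMap.id ℂ (Fock n)) (defect X)).adjoint ∘L
      opTensor (ContinuousLinearMap.id ℂ (Fock n)) (defect X) =
      1 - (reconstruction X).adjoint ∘L reconstruction X := by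
    rw [adjoint_opTensor, ← opTensor_comp, adjoint_defect_comp_defect hX,
      adjoint_reconstruction_comp, ContinuousLinearMap.adjoint_id, ContinuousLinearMap.id_comp,
      ← opTensorL_apply, map_sub, opTensorL_apply, opTensorL_apply, ContinuousLinearMap.one_def,
      opTensor_id]
    rfl
  have h2 : ‖ncPoissonKernel X h‖ ^ 2 = ‖g‖ ^ 2 - ‖reconstruction X g‖ ^ 2 := by
    rw [← inner_self_eq_norm_sq (𝕜 := ℂ), ← inner_self_eq_norm_sq (𝕜 := ℂ) g,
      ← inner_self_eq_norm_sq (𝕜 := ℂ) (reconstruction X g), ncPoissonKernel_apply, ← hg,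
      ← ContinuousLinearMap.adjoint_inner_left, ← ContinuousLinearMap.comp_apply, h1,
      sub_apply, inner_sub_left, map_sub, ContinuousLinearMap.comp_apply,
      ContinuousLinearMap.adjoint_inner_left]
    rfl
  have h3 : reconstruction X g = g - htmul (fockBasis n 1) h :=
    eq_sub_iff_add_eq.2 ((resolventVector_eq_iff hX).1 rfl).symm
  have hP : (vacuumProj n).adjoint = vacuumProj n := by
    refine (ContinuousLinearMap.eq_adjoint_iff _ _).2 (fun x y => ?_) |>.symm
    rw [vacuumProj_apply, vacuumProj_apply, inner_smul_left, inner_smul_right, inner_conj_symm]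
    ring
  have h4 : inner ℂ g (htmul (fockBasis n 1) h) = ((‖h‖ ^ 2 : ℝ) : ℂ) := by
    -- Moving the vacuum projection onto `g` replaces `g` by its known vacuum component `1 ⊗ h`.
    have h5 : htmul (fockBasis n 1) h = (opTensor (vacuumProj n) (ContinuousLinearMap.id ℂ H)).adjoint
        (htmul (fockBasis n 1) h) := by
      rw [adjoint_opTensor, hP, opTensor_htmul, vacuumProj_vacuum, ContinuousLinearMap.adjoint_id]
      rfl
    rw [h5, ContinuousLinearMap.adjoint_inner_right, vacuumProj_resolventVector hX, inner_htmul,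
      inner_self_eq_norm_sq_to_K, inner_self_eq_norm_sq_to_K, (fockBasis n).orthonormal.1]
    simp
  have h6 : ‖htmul (fockBasis n 1) h‖ = ‖h‖ := by
    rw [norm_htmul, (fockBasis n).orthonormal.1, one_mul]
  rw [h3, norm_sub_sq (𝕜 := ℂ), h4, h6] at h2
  have h7 : RCLike.re ((‖h‖ ^ 2 : ℝ) : ℂ) = ‖h‖ ^ 2 := Complex.ofReal_re _
  rw [h7] at h2
  rw [← sq_eq_sq₀ (norm_nonneg _) (norm_nonneg _), h2]
  ring

theorem adjoint_ncPoissonKernel_comp (hX : rowNorm X < 1) :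
    (ncPoissonKernel X).adjoint ∘L ncPoissonKernel X = ContinuousLinearMap.id ℂ H :=
  (ContinuousLinearMap.norm_map_iff_adjoint_comp_self _).1 (norm_ncPoissonKernel_apply hX)

theorem adjoint_ncPoissonKernel_comp_word (hX : rowNorm X < 1) (α : FreeMonoid (Fin n)) :
    (ncPoissonKernel X).adjoint ∘L
        opTensor (FreeMonoid.lift leftCreation α) (ContinuousLinearMap.id ℂ H) =
      FreeMonoid.lift X α ∘L (ncPoissonKernel X).adjoint := by
  induction α using FreeMonoid.inductionOn' with
  | one =>
    rw [map_one, map_one, ContinuousLinearMap.one_def, opTensor_id]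
    rfl
  | of_mul i α ih =>
    have h := congrArg ContinuousLinearMap.adjoint (adjoint_leftCreation_ncPoissonKernel hX i)
    rw [ContinuousLinearMap.adjoint_comp, ContinuousLinearMap.adjoint_comp, adjoint_opTensor,
      ContinuousLinearMap.adjoint_adjoint, ContinuousLinearMap.adjoint_adjoint,
      ContinuousLinearMap.adjoint_id] at h
    rw [map_mul, map_mul, FreeMonoid.lift_eval_of, FreeMonoid.lift_eval_of,
      ContinuousLinearMap.mul_def, ContinuousLinearMap.mul_def,
      ← ContinuousLinearMap.id_comp (ContinuousLinearMap.id ℂ H), opTensor_comp,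
      ← ContinuousLinearMap.comp_assoc, h, ContinuousLinearMap.comp_assoc, ih]
    rfl

end Kernel

/-! ### The Poisson transform -/

section Transform

variable {n : ℕ} {E H : Type*}
  [NormedAddCommGroup E] [InnerProductSpace ℂ E] [CompleteSpace E]
  [NormedAddCommGroup H] [InnerProductSpace ℂ H] [CompleteSpace H]
  {X : Fin n → H →L[ℂ] H}

variable (E) in
/-- The operator `I_E ⊗ K_X`, as an operator into `(E ⊗ F²) ⊗ H`. -/
def kernelEmbedding (X : Fin n → H →L[ℂ] H) :
    HilbertTensor E H →L[ℂ] HilbertTensor (HilbertTensor E (Fock n)) H :=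
  (hassoc E (Fock n) H).symm.toContinuousLinearEquiv.toContinuousLinearMap ∘L
    opTensor (ContinuousLinearMap.id ℂ E) (ncPoissonKernel X)

theorem adjoint_kernelEmbedding : (kernelEmbedding E X).adjoint =
    opTensor (ContinuousLinearMap.id ℂ E) (ncPoissonKernel X).adjoint ∘L
      (hassoc E (Fock n) H).toContinuousLinearEquiv.toContinuousLinearMap := by
  rw [kernelEmbedding, ContinuousLinearMap.adjoint_comp, adjoint_opTensor,
    ContinuousLinearMap.adjoint_id]
  congr 1
  exact LinearIsometryEquiv.adjoint_eq_symm (hassoc E (Fock n) H).symm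

theorem adjoint_kernelEmbedding_comp (hX : rowNorm X < 1) :
    (kernelEmbedding E X).adjoint ∘L kernelEmbedding E X =
      ContinuousLinearMap.id ℂ (HilbertTensor E H) := by
  have h : (hassoc E (Fock n) H).toContinuousLinearEquiv.toContinuousLinearMap ∘L
      (hassoc E (Fock n) H).symm.toContinuousLinearEquiv.toContinuousLinearMap =
      ContinuousLinearMap.id ℂ _ := by
    ext1 x
    exact (hassoc E (Fock n) H).apply_symm_apply x
  rw [adjoint_kernelEmbedding, kernelEmbedding, ContinuousLinearMap.comp_assoc,
    ← ContinuousLinearMap.comp_assoc _ _ (opTensor _ (ncPoissonKernel X)), h,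
    ContinuousLinearMap.id_comp, ← opTensor_comp, adjoint_ncPoissonKernel_comp hX,
    ContinuousLinearMap.id_comp, opTensor_id]

theorem norm_kernelEmbedding_apply (hX : rowNorm X < 1) (ξ : HilbertTensor E H) :
    ‖kernelEmbedding E X ξ‖ = ‖ξ‖ :=
  (ContinuousLinearMap.norm_map_iff_adjoint_comp_self _).2 (adjoint_kernelEmbedding_comp hX) ξ

theorem poissonTransform_eq (f : HilbertTensor E (Fock n) →L[ℂ] HilbertTensor E (Fock n)) :
    poissonTransform X f = (kernelEmbedding E X).adjoint ∘L
      opTensor f (ContinuousLinearMap.id ℂ H) ∘L kernelEmbedding E X := by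
  rw [adjoint_kernelEmbedding]
  rfl

omit [CompleteSpace E] in
theorem poissonTransform_opTensor (Y : E →L[ℂ] E) (Z : Fock n →L[ℂ] Fock n) :
    poissonTransform X (opTensor Y Z) = opTensor Y ((ncPoissonKernel X).adjoint ∘L
      opTensor Z (ContinuousLinearMap.id ℂ H) ∘L ncPoissonKernel X) := by
  have h : (hassoc E (Fock n) H).toContinuousLinearEquiv.toContinuousLinearMap ∘L
      opTensor (opTensor Y Z) (ContinuousLinearMap.id ℂ H) ∘L
      (hassoc E (Fock n) H).symm.toContinuousLinearEquiv.toContinuousLinearMap =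
      opTensor Y (opTensor Z (ContinuousLinearMap.id ℂ H)) := by
    rw [← ContinuousLinearMap.comp_assoc, hassoc_comp_opTensor]
    ext1 x
    exact congrArg _ ((hassoc E (Fock n) H).apply_symm_apply x)
  have h2 : poissonTransform X (opTensor Y Z) =
      opTensor (ContinuousLinearMap.id ℂ E) (ncPoissonKernel X).adjoint ∘L
      ((hassoc E (Fock n) H).toContinuousLinearEquiv.toContinuousLinearMap ∘L
      opTensor (opTensor Y Z) (ContinuousLinearMap.id ℂ H) ∘L
      (hassoc E (Fock n) H).symm.toContinuousLinearEquiv.toContinuousLinearMap) ∘L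
      opTensor (ContinuousLinearMap.id ℂ E) (ncPoissonKernel X) := rfl
  rw [h2, h, ← opTensor_comp, ← opTensor_comp]
  rfl

-- The intertwining relation gives `K_X* (S_α ⊗ I) K_X = X_α K_X* K_X`, and `K_X* K_X = I`.
omit [CompleteSpace E] in
theorem poissonTransform_word (hX : rowNorm X < 1) (Y : E →L[ℂ] E) (α : FreeMonoid (Fin n)) :
    poissonTransform X (opTensor Y (FreeMonoid.lift leftCreation α)) =
      opTensor Y (FreeMonoid.lift X α) := by
  rw [poissonTransform_opTensor, ← ContinuousLinearMap.comp_assoc,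
    adjoint_ncPoissonKernel_comp_word hX, ContinuousLinearMap.comp_assoc,
    adjoint_ncPoissonKernel_comp hX]
  rfl

theorem poissonTransform_adjoint (f : HilbertTensor E (Fock n) →L[ℂ] HilbertTensor E (Fock n)) :
    poissonTransform X f.adjoint = (poissonTransform X f).adjoint := by
  rw [poissonTransform_eq, poissonTransform_eq, ContinuousLinearMap.adjoint_comp,
    ContinuousLinearMap.adjoint_comp, ContinuousLinearMap.adjoint_adjoint, adjoint_opTensor,
    ContinuousLinearMap.adjoint_id]
  rfl

variable (E) in
/-- The Poisson transform, as a bounded linear map. -/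
def poissonL (X : Fin n → H →L[ℂ] H) :
    (HilbertTensor E (Fock n) →L[ℂ] HilbertTensor E (Fock n)) →L[ℂ]
      (HilbertTensor E H →L[ℂ] HilbertTensor E H) :=
  sandwich (kernelEmbedding E X).adjoint (kernelEmbedding E X) ∘L
    opTensorR _ _ (ContinuousLinearMap.id ℂ H)

theorem poissonL_apply (f : HilbertTensor E (Fock n) →L[ℂ] HilbertTensor E (Fock n)) :
    poissonL E X f = poissonTransform X f := by
  rw [poissonTransform_eq]
  rfl

theorem norm_kernelEmbedding_le (hX : rowNorm X < 1) : ‖kernelEmbedding E X‖ ≤ 1 :=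
  ContinuousLinearMap.opNorm_le_bound _ zero_le_one fun ξ => by
    rw [norm_kernelEmbedding_apply hX, one_mul]

theorem norm_poissonTransform_le (hX : rowNorm X < 1)
    (f : HilbertTensor E (Fock n) →L[ℂ] HilbertTensor E (Fock n)) :
    ‖poissonTransform X f‖ ≤ ‖f‖ := by
  rw [poissonTransform_eq]
  have h1 := norm_kernelEmbedding_le (E := E) hX
  have h2 : ‖(kernelEmbedding E X).adjoint‖ ≤ 1 :=
    (LinearIsometryEquiv.norm_map ContinuousLinearMap.adjoint (kernelEmbedding E X)).trans_le h1
  have h3 : ‖opTensor f (ContinuousLinearMap.id ℂ H)‖ ≤ ‖f‖ := (norm_opTensor_le _ _).trans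
    (mul_le_of_le_one_right (norm_nonneg _) ContinuousLinearMap.norm_id_le)
  calc _ ≤ ‖(kernelEmbedding E X).adjoint‖ *
        (‖opTensor f (ContinuousLinearMap.id ℂ H)‖ * ‖kernelEmbedding E X‖) :=
        (ContinuousLinearMap.opNorm_comp_le _ _).trans
          (mul_le_mul_of_nonneg_left (ContinuousLinearMap.opNorm_comp_le _ _) (norm_nonneg _))
    _ ≤ 1 * (‖f‖ * 1) := by gcongr
    _ = ‖f‖ := by ring

end Transform

/-! ### The boundary space -/

section Boundary

variable {n : ℕ} {E : Type*} [NormedAddCommGroup E] [InnerProductSpace ℂ E]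

theorem lift_leftCreation_mem_discAlgebra (α : FreeMonoid (Fin n)) :
    FreeMonoid.lift (leftCreation (n := n)) α ∈ discAlgebra n := by
  induction α using FreeMonoid.inductionOn' with
  | one => rw [map_one]; exact one_mem _
  | of_mul i α ih =>
    rw [map_mul, FreeMonoid.lift_eval_of]
    exact mul_mem (Subalgebra.le_topologicalClosure _ (Algebra.subset_adjoin ⟨i, rfl⟩)) ih

theorem word_mem_discSpace (Y : E →L[ℂ] E) (α : FreeMonoid (Fin n)) :
    opTensor Y (FreeMonoid.lift leftCreation α) ∈ discSpace n E :=
  opTensor_mem_minTensor trivial (lift_leftCreation_mem_discAlgebra α)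

/-- Two closures are crossed: the words in the `S_i` span the algebra they generate, and for fixed
`Y` the map `Z ↦ Y ⊗ Z` is continuous, which reaches all of `𝒜_n`; then comes the closure defining
the tensor product. -/
theorem discSpace_le {M : Submodule ℂ (HilbertTensor E (Fock n) →L[ℂ] HilbertTensor E (Fock n))}
    (hM : IsClosed (M : Set (HilbertTensor E (Fock n) →L[ℂ] HilbertTensor E (Fock n))))
    (h : ∀ (Y : E →L[ℂ] E) (α : FreeMonoid (Fin n)),
      opTensor Y (FreeMonoid.lift leftCreation α) ∈ M) : discSpace n E ≤ M := by
  refine Submodule.topologicalClosure_minimal _ (Submodule.span_le.2 ?_) hM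
  rintro _ ⟨Y, -, Z, hZ, rfl⟩
  have h1 : (Subalgebra.toSubmodule (Algebra.adjoin ℂ (Set.range (leftCreation (n := n))))) ≤
      M.comap (opTensorL (Fock n) (Fock n) Y).toLinearMap := by
    rw [Algebra.adjoin_eq_span, Submodule.span_le]
    intro Z hZ
    rw [← FreeMonoid.mrange_lift] at hZ
    obtain ⟨α, rfl⟩ := hZ
    exact h Y α
  have h2 : IsClosed ((M.comap (opTensorL (Fock n) (Fock n) Y).toLinearMap :
      Submodule ℂ (Fock n →L[ℂ] Fock n)) : Set (Fock n →L[ℂ] Fock n)) :=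
    hM.preimage (opTensorL (Fock n) (Fock n) Y).continuous
  exact closure_minimal (s := ((Algebra.adjoin ℂ (Set.range (leftCreation (n := n))) :
    Subalgebra ℂ (Fock n →L[ℂ] Fock n)) : Set (Fock n →L[ℂ] Fock n))) h1 h2 hZ

variable [CompleteSpace E]

omit [CompleteSpace E] in
theorem discSpace_le_boundarySpace : discSpace n E ≤ boundarySpace n E :=
  le_sup_right.trans (Submodule.le_topologicalClosure _)

omit [CompleteSpace E] in
theorem adjoint_mem_boundarySpace {f : HilbertTensor E (Fock n) →L[ℂ] HilbertTensor E (Fock n)}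
    (hf : f ∈ discSpace n E) : f.adjoint ∈ boundarySpace n E :=
  Submodule.le_topologicalClosure _ (Submodule.mem_sup_left ⟨f, hf, rfl⟩)

omit [CompleteSpace E] in
theorem isClosed_boundarySpace : IsClosed
    (boundarySpace n E : Set (HilbertTensor E (Fock n) →L[ℂ] HilbertTensor E (Fock n))) :=
  Submodule.isClosed_topologicalClosure _

-- The induction principle for boundary functions, used for every property that is linear and closed
-- in norm.
omit [CompleteSpace E] in
theorem boundarySpace_le
    {M : Submodule ℂ (HilbertTensor E (Fock n) →L[ℂ] HilbertTensor E (Fock n))}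
    (hM : IsClosed (M : Set (HilbertTensor E (Fock n) →L[ℂ] HilbertTensor E (Fock n))))
    (h1 : ∀ (Y : E →L[ℂ] E) (α : FreeMonoid (Fin n)),
      opTensor Y (FreeMonoid.lift leftCreation α) ∈ M)
    (h2 : ∀ (Y : E →L[ℂ] E) (α : FreeMonoid (Fin n)),
      (opTensor Y (FreeMonoid.lift leftCreation α)).adjoint ∈ M) : boundarySpace n E ≤ M := by
  refine Submodule.topologicalClosure_minimal _ (sup_le ?_ (discSpace_le hM h1)) hM
  have hle : discSpace n E ≤ M.comap (starLinearEquiv ℂ :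
      (HilbertTensor E (Fock n) →L[ℂ] HilbertTensor E (Fock n)) ≃ₗ⋆[ℂ] _).toLinearMap := by
    refine discSpace_le ?_ h2
    exact hM.preimage (ContinuousLinearMap.adjoint (𝕜 := ℂ) (E := HilbertTensor E (Fock n))
      (F := HilbertTensor E (Fock n))).continuous
  exact Submodule.map_le_iff_le_comap.2 hle

omit [CompleteSpace E] in
theorem eqOn_boundarySpace {W : Type*} [NormedAddCommGroup W] [NormedSpace ℂ W]
    {S T : (HilbertTensor E (Fock n) →L[ℂ] HilbertTensor E (Fock n)) →L[ℂ] W}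
    (h1 : ∀ (Y : E →L[ℂ] E) (α : FreeMonoid (Fin n)),
      S (opTensor Y (FreeMonoid.lift leftCreation α)) =
        T (opTensor Y (FreeMonoid.lift leftCreation α)))
    (h2 : ∀ (Y : E →L[ℂ] E) (α : FreeMonoid (Fin n)),
      S (opTensor Y (FreeMonoid.lift leftCreation α)).adjoint =
        T (opTensor Y (FreeMonoid.lift leftCreation α)).adjoint)
    {f : HilbertTensor E (Fock n) →L[ℂ] HilbertTensor E (Fock n)} (hf : f ∈ boundarySpace n E) :
    S f = T f :=
  boundarySpace_le (M := LinearMap.eqLocus S.toLinearMap T.toLinearMap)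
    (isClosed_eq S.continuous T.continuous) h1 h2 hf

theorem powerSum_smul_leftCreation_mem {A : FreeMonoid (Fin n) → E →L[ℂ] E}
    (hA : 1 ≤ radiusOfConvergence A) {c : ℂ} (hc : rowNorm (c • leftCreation (n := n)) < 1) :
    powerSum A (c • leftCreation) ∈ discSpace n E := by
  refine (Submodule.isClosed_topologicalClosure _).mem_of_tendsto (hasSum_powerSum hA hc)
    (Filter.Eventually.of_forall fun _ => Submodule.sum_mem _ fun k _ => ?_)
  rw [homogeneousPart_smul_point]
  exact Submodule.smul_mem _ _ (Submodule.sum_mem _ fun w _ => word_mem_discSpace _ _)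

end Boundary

/-! ### Fourier coefficients -/

section Coefficients

variable {n : ℕ} {E : Type*} [NormedAddCommGroup E] [InnerProductSpace ℂ E] [CompleteSpace E]

theorem adjoint_htmulRight_htmul (α : FreeMonoid (Fin n)) (x : E) (y : Fock n) :
    (htmulRight E (fockBasis n α)).adjoint (htmul x y) = (inner ℂ (fockBasis n α) y : ℂ) • x := by
  refine ext_inner_left ℂ fun z => ?_
  rw [ContinuousLinearMap.adjoint_inner_right, htmulRight_apply, inner_htmul, inner_smul_right,
    mul_comm]

/-- Bessel's inequality with coefficients in `E`: `η = ∑ c_i ⊗ e_{a i}` satisfies `⟨ξ, η⟩ = ‖η‖² = ∑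
‖c_i‖²`, and `‖ξ - η‖² ≥ 0`. -/
theorem sum_norm_adjoint_htmulRight_sq_le {ι : Type*} [Fintype ι] {a : ι → FreeMonoid (Fin n)}
    (ha : Function.Injective a) (ξ : HilbertTensor E (Fock n)) :
    ∑ i, ‖(htmulRight E (fockBasis n (a i))).adjoint ξ‖ ^ 2 ≤ ‖ξ‖ ^ 2 := by
  classical
  set c : ι → E := fun i => (htmulRight E (fockBasis n (a i))).adjoint ξ with hc
  set η : HilbertTensor E (Fock n) := ∑ i, htmul (c i) (fockBasis n (a i)) with hη
  have h1 : inner ℂ ξ η = ((∑ i, ‖c i‖ ^ 2 : ℝ) : ℂ) := by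
    rw [hη, inner_sum]
    push_cast
    refine Finset.sum_congr rfl fun i _ => ?_
    rw [← htmulRight_apply, ← ContinuousLinearMap.adjoint_inner_left]
    exact inner_self_eq_norm_sq_to_K _
  have h2 : inner ℂ η η = ((∑ i, ‖c i‖ ^ 2 : ℝ) : ℂ) := by
    nth_rewrite 1 [hη]
    rw [sum_inner]
    push_cast
    refine Finset.sum_congr rfl fun i _ => ?_
    rw [hη, inner_sum, Finset.sum_eq_single i]
    · rw [inner_htmul, inner_fockBasis, if_pos rfl, mul_one]
      exact inner_self_eq_norm_sq_to_K _
    · intro j _ hj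
      rw [inner_htmul, inner_fockBasis, if_neg fun h => hj (ha h).symm, mul_zero]
    · simp
  have h3 : ‖η‖ ^ 2 = ∑ i, ‖c i‖ ^ 2 := by
    rw [← inner_self_eq_norm_sq (𝕜 := ℂ), h2]
    exact Complex.ofReal_re _
  have h4 := norm_sub_sq (𝕜 := ℂ) ξ η
  have h5 : RCLike.re ((∑ i, ‖c i‖ ^ 2 : ℝ) : ℂ) = ∑ i, ‖c i‖ ^ 2 := Complex.ofReal_re _
  rw [h1, h5, h3] at h4
  nlinarith [sq_nonneg ‖ξ - η‖]

/-- The coefficient of `f` at the word `α`: the entry of `f` from the vacuum to `e_α`. -/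
def coeff (f : HilbertTensor E (Fock n) →L[ℂ] HilbertTensor E (Fock n)) (α : FreeMonoid (Fin n)) :
    E →L[ℂ] E :=
  sandwich (htmulRight E (fockBasis n α)).adjoint (htmulRight E (fockBasis n 1)) f

theorem coeff_add (f g : HilbertTensor E (Fock n) →L[ℂ] HilbertTensor E (Fock n)) :
    coeff (f + g) = coeff f + coeff g :=
  funext fun _ => map_add (sandwich _ _) f g

theorem coeff_smul (c : ℂ) (f : HilbertTensor E (Fock n) →L[ℂ] HilbertTensor E (Fock n)) :
    coeff (c • f) = c • coeff f :=
  funext fun _ => map_smul (sandwich _ _) c f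

/-- Bessel applied to `f (x ⊗ 1)`. Every bounded operator thus has an analytic part on the open
ball, whether or not it is a boundary function. -/
theorem columnNorm_coeff_le (f : HilbertTensor E (Fock n) →L[ℂ] HilbertTensor E (Fock n)) (k : ℕ) :
    columnNorm (coeff f) k ≤ ‖f‖ := by
  refine columnNorm_le (norm_nonneg f) fun x => ?_
  refine (sum_norm_adjoint_htmulRight_sq_le word_injective (f (htmul x (fockBasis n 1)))).trans ?_
  rw [← mul_pow]
  refine pow_le_pow_left₀ (norm_nonneg _) ((f.le_opNorm _).trans_eq ?_) 2
  rw [norm_htmul, (fockBasis n).orthonormal.1, mul_one]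

theorem one_le_radiusOfConvergence_coeff
    (f : HilbertTensor E (Fock n) →L[ℂ] HilbertTensor E (Fock n)) :
    1 ≤ radiusOfConvergence (coeff f) :=
  one_le_radiusOfConvergence fun _ ht => ⟨‖f‖, fun k => (columnNorm_coeff_le f k).trans
    (le_mul_of_one_le_right (norm_nonneg f) (one_le_pow₀ ht.le))⟩

theorem coeff_opTensor (Y : E →L[ℂ] E) (Z : Fock n →L[ℂ] Fock n) (α : FreeMonoid (Fin n)) :
    coeff (opTensor Y Z) α = (inner ℂ (fockBasis n α) (Z (fockBasis n 1)) : ℂ) • Y := by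
  ext1 x
  change (htmulRight E (fockBasis n α)).adjoint (opTensor Y Z (htmul x (fockBasis n 1))) = _
  rw [opTensor_htmul, adjoint_htmulRight_htmul]
  rfl

open Classical in
theorem coeff_word (Y : E →L[ℂ] E) (α : FreeMonoid (Fin n)) :
    coeff (opTensor Y (FreeMonoid.lift leftCreation α)) = Pi.single α Y := by
  funext β
  rw [coeff_opTensor, lift_leftCreation_fockBasis, mul_one, inner_fockBasis, Pi.single_apply]
  split_ifs
  · rw [one_smul]
  · rw [zero_smul]

open Classical in
theorem coeff_adjoint_word (Y : E →L[ℂ] E) (α : FreeMonoid (Fin n)) :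
    coeff (opTensor Y (FreeMonoid.lift leftCreation α)).adjoint =
      if α = 1 then Pi.single 1 Y.adjoint else 0 := by
  funext β
  rw [adjoint_opTensor, coeff_opTensor, ContinuousLinearMap.adjoint_inner_right,
    lift_leftCreation_fockBasis, inner_fockBasis]
  have h : α * β = 1 ↔ α = 1 ∧ β = 1 := by
    rw [← FreeMonoid.length_eq_zero, ← FreeMonoid.length_eq_zero, ← FreeMonoid.length_eq_zero,
      FreeMonoid.length_mul, Nat.add_eq_zero_iff]
  by_cases h1 : α = 1
  · by_cases h2 : β = 1
    · rw [if_pos (h.2 ⟨h1, h2⟩), if_pos h1, h2, Pi.single_eq_same, one_smul]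
    · rw [if_neg fun h3 => h2 (h.1 h3).2, if_pos h1, Pi.single_eq_of_ne h2, zero_smul]
  · rw [if_neg fun h3 => h1 (h.1 h3).1, if_neg h1, zero_smul]
    rfl

omit [CompleteSpace E] in
theorem opTensor_zero_left {F : Type*} [NormedAddCommGroup F] [InnerProductSpace ℂ F]
    (B : F →L[ℂ] F) : opTensor (0 : E →L[ℂ] E) B = 0 :=
  map_zero (opTensorR E E B)

theorem word_ne_word {j k : ℕ} (h : j ≠ k) (v : Fin j → Fin n) (w : Fin k → Fin n) :
    word v ≠ word w := fun h1 => h (by rw [← word_length v, h1, word_length])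

open Classical in
theorem columnNorm_single_le (α : FreeMonoid (Fin n)) (Y : E →L[ℂ] E) (k : ℕ) :
    columnNorm (Pi.single α Y) k ≤ ‖Y‖ := by
  obtain ⟨j, v, rfl⟩ := exists_word α
  refine columnNorm_le (norm_nonneg Y) fun x => ?_
  rw [← mul_pow]
  rcases eq_or_ne j k with rfl | h
  · rw [Finset.sum_eq_single v, Pi.single_eq_same]
    · exact pow_le_pow_left₀ (norm_nonneg _) (Y.le_opNorm x) 2
    · intro w _ hw
      rw [Pi.single_eq_of_ne fun h1 => hw (word_injective h1)]
      simp
    · simp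
  · rw [Finset.sum_eq_zero]
    · positivity
    · intro w _
      rw [Pi.single_eq_of_ne (word_ne_word h v w).symm]
      simp

open Classical in
theorem one_le_radiusOfConvergence_single (α : FreeMonoid (Fin n)) (Y : E →L[ℂ] E) :
    1 ≤ radiusOfConvergence (Pi.single α Y) :=
  one_le_radiusOfConvergence fun _ ht => ⟨‖Y‖, fun k => (columnNorm_single_le α Y k).trans
    (le_mul_of_one_le_right (norm_nonneg Y) (one_le_pow₀ ht.le))⟩

/-! ### Power series expansion of the Poisson transform. -/

variable {K : Type*} [NormedAddCommGroup K] [InnerProductSpace ℂ K] [CompleteSpace K]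

open Classical in
omit [CompleteSpace E] [CompleteSpace K] in
theorem powerSum_single (α : FreeMonoid (Fin n)) (Y : E →L[ℂ] E) (X : Fin n → K →L[ℂ] K) :
    powerSum (Pi.single α Y) X = opTensor Y (FreeMonoid.lift X α) := by
  obtain ⟨j, v, rfl⟩ := exists_word α
  rw [powerSum, tsum_eq_single j]
  · rw [homogeneousPart, Finset.sum_eq_single v, Pi.single_eq_same]
    · intro w _ hw
      rw [Pi.single_eq_of_ne fun h1 => hw (word_injective h1), opTensor_zero_left]
    · simp
  · intro k hk
    refine Finset.sum_eq_zero fun w _ => ?_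
    rw [Pi.single_eq_of_ne (word_ne_word hk w v), opTensor_zero_left]

omit [CompleteSpace E] [CompleteSpace K] in
theorem powerSum_zero (X : Fin n → K →L[ℂ] K) :
    powerSum (0 : FreeMonoid (Fin n) → E →L[ℂ] E) X = 0 := by
  simp [powerSum, homogeneousPart, opTensor_zero_left]

variable {X : Fin n → K →L[ℂ] K}

/-- A geometric series bound; it makes the analytic part at `X` continuous in `f`, so that
identities extend from the generators. -/
theorem norm_powerSum_coeff_le (hX : rowNorm X < 1)
    (f : HilbertTensor E (Fock n) →L[ℂ] HilbertTensor E (Fock n)) :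
    ‖powerSum (coeff f) X‖ ≤ (1 - rowNorm X)⁻¹ * ‖f‖ := by
  have h1 := (hasSum_geometric_of_lt_one (rowNorm_nonneg X) hX).mul_left ‖f‖
  rw [mul_comm]
  refine tsum_of_norm_bounded (f := homogeneousPart (coeff f) X) h1 fun k => ?_
  exact (norm_homogeneousPart_le _ X k).trans (mul_le_mul_of_nonneg_right
    (columnNorm_coeff_le f k) (pow_nonneg (rowNorm_nonneg X) k))

/-- The analytic part of an operator on `E ⊗ F²`, evaluated at `X`. -/
def analyticPart (hX : rowNorm X < 1) :
    (HilbertTensor E (Fock n) →L[ℂ] HilbertTensor E (Fock n)) →L[ℂ]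
      (HilbertTensor E K →L[ℂ] HilbertTensor E K) :=
  LinearMap.mkContinuous (IsLinearMap.mk' (fun f => powerSum (coeff f) X)
    ⟨fun f g => by
      rw [coeff_add]
      exact powerSum_add (one_le_radiusOfConvergence_coeff f) (one_le_radiusOfConvergence_coeff g)
        hX,
    fun c f => by
      rw [coeff_smul]
      exact powerSum_smul c (one_le_radiusOfConvergence_coeff f) hX⟩)
    (1 - rowNorm X)⁻¹ fun f => norm_powerSum_coeff_le hX f

variable (K) in
/-- The map `T ↦ T*`, as a continuous conjugate linear map. -/
def adjointL : (K →L[ℂ] K) →L⋆[ℂ] (K →L[ℂ] K) :=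
  (ContinuousLinearMap.adjoint (𝕜 := ℂ) (E := K) (F := K)).toContinuousLinearEquiv

/-- Both sides are bounded and linear in `f`, so generators suffice. The constant coefficient occurs
in the series of `f` and again in that of `f*`, hence the correction. -/
theorem poissonTransform_eq_powerSum (hX : rowNorm X < 1)
    {f : HilbertTensor E (Fock n) →L[ℂ] HilbertTensor E (Fock n)} (hf : f ∈ boundarySpace n E) :
    poissonTransform X f = powerSum (coeff f) X +
      ((powerSum (coeff f.adjoint) X).adjoint - opTensor (coeff f 1) 1) := by
  classical
  -- The right side as a bounded operator; the coanalytic term is complex linear because it contains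
  -- two conjugate linear adjoints.
  let T : (HilbertTensor E (Fock n) →L[ℂ] HilbertTensor E (Fock n)) →L[ℂ]
      (HilbertTensor E K →L[ℂ] HilbertTensor E K) := analyticPart hX +
    (((adjointL (HilbertTensor E K)).comp ((analyticPart hX).comp
      (adjointL (HilbertTensor E (Fock n))))) -
      opTensorR E E (1 : K →L[ℂ] K) ∘L
        sandwich (htmulRight E (fockBasis n 1)).adjoint (htmulRight E (fockBasis n 1)))
  have hT : ∀ f, T f = powerSum (coeff f) X +
      ((powerSum (coeff f.adjoint) X).adjoint - opTensor (coeff f 1) 1) := fun f => rfl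
  rw [← poissonL_apply, ← hT]
  refine eqOn_boundarySpace (W := HilbertTensor E K →L[ℂ] HilbertTensor E K) (S := poissonL E X)
    (T := T) (fun Y α => ?_) (fun Y α => ?_) hf
  · rw [hT, poissonL_apply, poissonTransform_word hX, coeff_word, powerSum_single,
      coeff_adjoint_word]
    by_cases h : α = 1
    · subst h
      rw [if_pos rfl, powerSum_single, Pi.single_eq_same, map_one, adjoint_opTensor,
        ContinuousLinearMap.adjoint_adjoint, ContinuousLinearMap.one_def,
        ContinuousLinearMap.adjoint_id, sub_self, add_zero]
    · rw [if_neg h, Pi.single_eq_of_ne (Ne.symm h), opTensor_zero_left, sub_zero, powerSum_zero,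
        map_zero, add_zero]
  · rw [hT, poissonL_apply, poissonTransform_adjoint, poissonTransform_word hX,
      ContinuousLinearMap.adjoint_adjoint, coeff_word, powerSum_single, coeff_adjoint_word]
    by_cases h : α = 1
    · subst h
      rw [if_pos rfl, powerSum_single, Pi.single_eq_same, map_one, adjoint_opTensor,
        ContinuousLinearMap.one_def, ContinuousLinearMap.adjoint_id, add_sub_cancel]
    · rw [if_neg h, powerSum_zero, zero_add, Pi.zero_apply, opTensor_zero_left, sub_zero]

theorem poissonTransform_mem (hX : rowNorm X < 1)
    {f : HilbertTensor E (Fock n) →L[ℂ] HilbertTensor E (Fock n)} (hf : f ∈ boundarySpace n E) :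
    poissonTransform X f ∈
      minTensor (⊤ : Submodule ℂ (E →L[ℂ] E)) (⊤ : Submodule ℂ (K →L[ℂ] K)) := by
  rw [← poissonL_apply]
  refine boundarySpace_le (M := (minTensor (⊤ : Submodule ℂ (E →L[ℂ] E))
    (⊤ : Submodule ℂ (K →L[ℂ] K))).comap (poissonL E X).toLinearMap) ?_ (fun Y α => ?_)
    (fun Y α => ?_) hf
  · exact (Submodule.isClosed_topologicalClosure _).preimage (poissonL E X).continuous
  · rw [Submodule.mem_comap, ContinuousLinearMap.coe_coe, poissonL_apply, poissonTransform_word hX]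
    exact opTensor_mem_minTensor trivial trivial
  · rw [Submodule.mem_comap, ContinuousLinearMap.coe_coe, poissonL_apply, poissonTransform_adjoint, poissonTransform_word hX, adjoint_opTensor]
    exact opTensor_mem_minTensor trivial trivial

open Classical in
/-- The coefficients of the antianalytic part of `f`, without the constant one. -/
def antiCoeff (f : HilbertTensor E (Fock n) →L[ℂ] HilbertTensor E (Fock n)) :
    FreeMonoid (Fin n) → E →L[ℂ] E :=
  coeff f.adjoint + (-1 : ℂ) • (Pi.single 1 (coeff f 1).adjoint : FreeMonoid (Fin n) → E →L[ℂ] E)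

theorem one_le_radiusOfConvergence_antiCoeff
    (f : HilbertTensor E (Fock n) →L[ℂ] HilbertTensor E (Fock n)) :
    1 ≤ radiusOfConvergence (antiCoeff f) :=
  one_le_radiusOfConvergence_add (one_le_radiusOfConvergence_coeff _)
    (one_le_radiusOfConvergence_smul _ (one_le_radiusOfConvergence_single _ _))

/-- The Poisson transform of an element of the boundary space is free pluriharmonic, with
coefficients which do not depend on the underlying Hilbert space. -/
theorem isFreePluriharmonicWith_poissonTransform
    {f : HilbertTensor E (Fock n) →L[ℂ] HilbertTensor E (Fock n)} (hf : f ∈ boundarySpace n E)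
    {u : OpenBall n K → MinOp E K} (hu : ∀ X, (u X).1 = poissonTransform X.1 f) :
    IsFreePluriharmonicWith (coeff f + antiCoeff f)
      ((-Complex.I) • coeff f + Complex.I • antiCoeff f) u := by
  classical
  refine isFreePluriharmonicWith_of_eq (one_le_radiusOfConvergence_coeff f)
    (one_le_radiusOfConvergence_antiCoeff f) fun X => ?_
  have hs := one_le_radiusOfConvergence_single (1 : FreeMonoid (Fin n)) (coeff f 1).adjoint
  rw [hu, poissonTransform_eq_powerSum X.2 hf, antiCoeff,
    powerSum_add (one_le_radiusOfConvergence_coeff _) (one_le_radiusOfConvergence_smul _ hs) X.2,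
    powerSum_smul _ hs X.2, powerSum_single, map_add, map_smulₛₗ, adjoint_opTensor,
    ContinuousLinearMap.adjoint_adjoint, map_one, ContinuousLinearMap.one_def,
    ContinuousLinearMap.adjoint_id, map_neg, map_one, neg_smul, one_smul, sub_eq_add_neg]

end Coefficients

/-! ### Radial limits -/

section Radial

/-- The filter `r → 1`, `0 ≤ r < 1`. -/
abbrev radial : Filter (Set.Ico (0 : ℝ) 1) := Filter.comap Subtype.val (𝓝 1)

instance : radial.NeBot :=
  mem_closure_iff_comap_neBot.1 (by
    rw [closure_Ico zero_ne_one]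
    exact ⟨zero_le_one, le_rfl⟩)

theorem tendsto_ofReal_radial :
    Filter.Tendsto (fun r : Set.Ico (0 : ℝ) 1 => ((r : ℝ) : ℂ)) radial (𝓝 1) := by
  have h := (Complex.continuous_ofReal.tendsto 1).comp
    (Filter.tendsto_comap (f := (Subtype.val : Set.Ico (0 : ℝ) 1 → ℝ)) (x := 𝓝 1))
  rwa [Complex.ofReal_one] at h

theorem continuous_adjoint {K : Type*} [NormedAddCommGroup K] [InnerProductSpace ℂ K]
    [CompleteSpace K] : Continuous fun T : K →L[ℂ] K => T.adjoint :=
  (ContinuousLinearMap.adjoint (𝕜 := ℂ) (E := K) (F := K)).continuous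

/-- The vectors `x` for which `T i x` tends to `x`. -/
def convergenceSubmodule {ι V : Type*} [NormedAddCommGroup V] [NormedSpace ℂ V]
    (T : ι → V →L[ℂ] V) (l : Filter ι) : Submodule ℂ V where
  carrier := {x | Filter.Tendsto (fun i => T i x) l (𝓝 x)}
  add_mem' {x y} hx hy := by
    simpa only [Set.mem_ofPred_eq, map_add] using Filter.Tendsto.add hx hy
  zero_mem' := by simpa only [Set.mem_ofPred_eq, map_zero] using tendsto_const_nhds
  smul_mem' c x hx := by
    simpa only [Set.mem_ofPred_eq, map_smul] using Filter.Tendsto.const_smul hx c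

/-- An `ε/3` argument; contractivity is what makes the approximation uniform in `i`. -/
theorem isClosed_convergenceSubmodule {ι V : Type*} [NormedAddCommGroup V] [NormedSpace ℂ V]
    {T : ι → V →L[ℂ] V} (l : Filter ι) (hT : ∀ i x, ‖T i x‖ ≤ ‖x‖) :
    IsClosed (convergenceSubmodule T l : Set V) := by
  refine isClosed_of_closure_subset fun x hx => Metric.tendsto_nhds.2 fun ε hε => ?_
  obtain ⟨y, hy, hxy⟩ := Metric.mem_closure_iff.1 hx (ε / 3) (by positivity)
  filter_upwards [Metric.tendsto_nhds.1 hy (ε / 3) (by positivity)] with i hi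
  have h1 : dist (T i x) (T i y) ≤ dist x y := by
    rw [dist_eq_norm, dist_eq_norm, ← map_sub]
    exact hT i _
  have h2 := dist_triangle4 (T i x) (T i y) y x
  rw [dist_comm y x] at h2
  linarith

variable {n : ℕ} {E K : Type*} [NormedAddCommGroup E] [InnerProductSpace ℂ E] [CompleteSpace E]
  [NormedAddCommGroup K] [InnerProductSpace ℂ K] [CompleteSpace K]

/-- On a word of length `k` the transform at `rS` multiplies by `r ^ k`, which tends to 1;
contractivity carries the limit to the closure. -/
theorem tendsto_poissonTransform_scaledCreation
    {f : HilbertTensor E (Fock n) →L[ℂ] HilbertTensor E (Fock n)} (hf : f ∈ boundarySpace n E) :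
    Filter.Tendsto (fun r => poissonTransform (scaledCreation n r).1 f) radial (𝓝 f) := by
  have h1 : ∀ (Y : E →L[ℂ] E) (α : FreeMonoid (Fin n)),
      Filter.Tendsto (fun r => poissonTransform (scaledCreation n r).1
        (opTensor Y (FreeMonoid.lift leftCreation α))) radial
        (𝓝 (opTensor Y (FreeMonoid.lift leftCreation α))) := by
    intro Y α
    obtain ⟨k, w, rfl⟩ := exists_word α
    have h : ∀ r : Set.Ico (0 : ℝ) 1, poissonTransform (scaledCreation n r).1
        (opTensor Y (FreeMonoid.lift leftCreation (word w))) =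
        ((r : ℝ) : ℂ) ^ k • opTensor Y (FreeMonoid.lift leftCreation (word w)) := fun r => by
      rw [poissonTransform_word (scaledCreation n r).2, ← opTensor_smul_right, ← lift_smul_word]
      rfl
    simp only [h]
    have h2 := (tendsto_ofReal_radial.pow k).smul_const
      (opTensor Y (FreeMonoid.lift leftCreation (word w)))
    rwa [one_pow, one_smul] at h2
  let M : Submodule ℂ (HilbertTensor E (Fock n) →L[ℂ] HilbertTensor E (Fock n)) :=
    convergenceSubmodule (V := HilbertTensor E (Fock n) →L[ℂ] HilbertTensor E (Fock n))
      (fun r => poissonL E (scaledCreation n r).1) radial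
  have hM : ∀ g, g ∈ M ↔ Filter.Tendsto (fun r => poissonTransform (scaledCreation n r).1 g)
      radial (𝓝 g) := fun g => by
    change Filter.Tendsto (fun r => poissonL E (scaledCreation n r).1 g) radial (𝓝 g) ↔ _
    simp only [poissonL_apply]
  rw [← hM]
  refine boundarySpace_le (M := M)
    (isClosed_convergenceSubmodule _ fun r g => ?_) (fun Y α => (hM _).2 (h1 Y α))
    (fun Y α => (hM _).2 ?_) hf
  · rw [poissonL_apply]
    exact norm_poissonTransform_le (scaledCreation n r).2 g
  · have h2 := (continuous_adjoint.tendsto _).comp (h1 Y α)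
    refine h2.congr fun r => ?_
    exact (poissonTransform_adjoint _).symm

theorem IsFreePluriharmonicWith.tendsto_dilate {A B : FreeMonoid (Fin n) → E →L[ℂ] E}
    {u : OpenBall n K → MinOp E K} (h : IsFreePluriharmonicWith A B u) (X : OpenBall n K) :
    Filter.Tendsto (fun r => (u (dilate r X.1 X.2.le)).1) radial (𝓝 (u X).1) := by
  simp only [h.eq_powerSum]
  have hs := fun c : ℂ => one_le_radiusOfConvergence_smul c h.radius.1
  have ht := fun c : ℂ => one_le_radiusOfConvergence_smul c h.radius.2
  exact (tendsto_powerSum_dilate (one_le_radiusOfConvergence_add (hs _) (ht _)) X.2).add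
    ((continuous_adjoint.tendsto _).comp
      (tendsto_powerSum_dilate (one_le_radiusOfConvergence_add (hs _) (ht _)) X.2))

/-- Term by term, `P_X` replaces `S_α` by `X_α` and leaves the factor `r ^ k` in place. -/
theorem poissonTransform_powerSum {A : FreeMonoid (Fin n) → E →L[ℂ] E}
    (hA : 1 ≤ radiusOfConvergence A) {X : Fin n → K →L[ℂ] K} (hX : rowNorm X < 1)
    (r : Set.Ico (0 : ℝ) 1) :
    poissonTransform X (powerSum A (scaledCreation n r).1) = powerSum A (dilate r X hX.le).1 := by
  have h1 := (poissonL E X).hasSum (hasSum_powerSum hA (scaledCreation n r).2)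
  refine (HasSum.tsum_eq ?_).symm
  rw [poissonL_apply] at h1
  convert h1 using 1
  funext k
  change homogeneousPart A (((r : ℝ) : ℂ) • X) k =
    poissonL E X (homogeneousPart A (((r : ℝ) : ℂ) • leftCreation) k)
  rw [homogeneousPart_smul_point, homogeneousPart_smul_point, map_smul, homogeneousPart,
    homogeneousPart, map_sum]
  simp only [poissonL_apply, poissonTransform_word hX]

theorem IsFreePluriharmonicWith.poissonTransform_eq {A B : FreeMonoid (Fin n) → E →L[ℂ] E}
    {u : OpenBall n K → MinOp E K} {v : OpenBall n (Fock n) → MinOp E (Fock n)}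
    (hu : IsFreePluriharmonicWith A B u) (hv : IsFreePluriharmonicWith A B v) (X : OpenBall n K)
    (r : Set.Ico (0 : ℝ) 1) :
    poissonTransform X.1 (v (scaledCreation n r)).1 = (u (dilate r X.1 X.2.le)).1 := by
  have hs := fun c : ℂ => one_le_radiusOfConvergence_smul c hu.radius.1
  have ht := fun c : ℂ => one_le_radiusOfConvergence_smul c hu.radius.2
  rw [hv.eq_powerSum, hu.eq_powerSum, ← poissonL_apply, map_add, poissonL_apply, poissonL_apply,
    poissonTransform_adjoint,
    poissonTransform_powerSum (one_le_radiusOfConvergence_add (hs _) (ht _)) X.2,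
    poissonTransform_powerSum (one_le_radiusOfConvergence_add (hs _) (ht _)) X.2]

theorem IsFreePluriharmonicWith.mem_boundarySpace {A B : FreeMonoid (Fin n) → E →L[ℂ] E}
    {v : OpenBall n (Fock n) → MinOp E (Fock n)} (hv : IsFreePluriharmonicWith A B v)
    (r : Set.Ico (0 : ℝ) 1) : (v (scaledCreation n r)).1 ∈ boundarySpace n E := by
  have hs := fun c : ℂ => one_le_radiusOfConvergence_smul c hv.radius.1
  have ht := fun c : ℂ => one_le_radiusOfConvergence_smul c hv.radius.2
  rw [hv.eq_powerSum]
  exact add_mem (discSpace_le_boundarySpace (powerSum_smul_leftCreation_mem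
      (one_le_radiusOfConvergence_add (hs _) (ht _)) (scaledCreation n r).2))
    (adjoint_mem_boundarySpace (powerSum_smul_leftCreation_mem
      (one_le_radiusOfConvergence_add (hs _) (ht _)) (scaledCreation n r).2))

/-- A radial limit is a boundary function. -/
theorem poissonTransform_of_radialLimit {u : OpenBall n K → MinOp E K}
    {v : OpenBall n (Fock n) → MinOp E (Fock n)} (h : IsFockRepresentation u v)
    {g : HilbertTensor E (Fock n) →L[ℂ] HilbertTensor E (Fock n)} (hg : RadialLimit v g) :
    g ∈ boundarySpace n E ∧ ∀ X : OpenBall n K, (u X).1 = poissonTransform X.1 g := by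
  obtain ⟨A, B, hu, hv⟩ := h
  refine ⟨isClosed_boundarySpace.mem_of_tendsto (b := radial) hg
    (Filter.Eventually.of_forall hv.mem_boundarySpace), fun X => ?_⟩
  -- The values `u(rX) = P_X[v(rS)]` tend to `u(X)` by Abel summation and to `P_X[g]` by continuity
  -- of `P_X`.
  refine tendsto_nhds_unique (hu.tendsto_dilate X) ?_
  have h1 := ((poissonL E X.1).continuous.tendsto g).comp hg
  rw [poissonL_apply] at h1
  refine h1.congr fun r => ?_
  rw [Function.comp_apply, poissonL_apply, hu.poissonTransform_eq hv]

/-- The Poisson transform of `f`, as a function on the open ball. -/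
def poissonFun (K : Type*) [NormedAddCommGroup K] [InnerProductSpace ℂ K] [CompleteSpace K]
    {f : HilbertTensor E (Fock n) →L[ℂ] HilbertTensor E (Fock n)} (hf : f ∈ boundarySpace n E) :
    OpenBall n K → MinOp E K :=
  fun X => ⟨poissonTransform X.1 f, poissonTransform_mem X.2 hf⟩

/-- The coefficients come from `f` alone, so the Poisson transform of `f` on the Fock space shares
them with `u`. -/
theorem exists_isFockRepresentation {u : OpenBall n K → MinOp E K}
    {f : HilbertTensor E (Fock n) →L[ℂ] HilbertTensor E (Fock n)} (hf : f ∈ boundarySpace n E)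
    (hu : ∀ X : OpenBall n K, (u X).1 = poissonTransform X.1 f) :
    ∃ v, IsFockRepresentation u v ∧ RadialLimit v f :=
  ⟨poissonFun (Fock n) hf, ⟨_, _, isFreePluriharmonicWith_poissonTransform hf hu,
    isFreePluriharmonicWith_poissonTransform hf fun _ => rfl⟩,
    tendsto_poissonTransform_scaledCreation hf⟩

end Radial

/-! ### Continuous extension to the closed ball -/

section Extension

variable {n : ℕ} {E K : Type*} [NormedAddCommGroup E] [InnerProductSpace ℂ E] [CompleteSpace E]
  [NormedAddCommGroup K] [InnerProductSpace ℂ K] [CompleteSpace K]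

theorem norm_lift_le_one {X : Fin n → K →L[ℂ] K} (hX : rowNorm X ≤ 1) (α : FreeMonoid (Fin n)) :
    ‖FreeMonoid.lift X α‖ ≤ 1 := by
  induction α using FreeMonoid.inductionOn' with
  | one => rw [map_one]; exact ContinuousLinearMap.norm_id_le
  | of_mul i α ih =>
    rw [map_mul, FreeMonoid.lift_eval_of]
    exact (norm_mul_le _ _).trans
      (mul_le_one₀ ((norm_apply_le_rowNorm X i).trans hX) (norm_nonneg _) ih)

/-- Telescoping over the letters, all factors being contractions; each letter adds 1 to the
constant. -/
theorem exists_norm_lift_sub_le (α : FreeMonoid (Fin n)) : ∃ C : NNReal,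
    ∀ X Y : Fin n → K →L[ℂ] K, rowNorm X ≤ 1 → rowNorm Y ≤ 1 →
      ‖FreeMonoid.lift X α - FreeMonoid.lift Y α‖ ≤ C * ‖X - Y‖ := by
  induction α using FreeMonoid.inductionOn' with
  | one => exact ⟨0, fun X Y _ _ => by simp⟩
  | of_mul i α ih =>
    obtain ⟨C, hC⟩ := ih
    refine ⟨1 + C, fun X Y hX hY => ?_⟩
    rw [map_mul, map_mul, FreeMonoid.lift_eval_of, FreeMonoid.lift_eval_of]
    have h1 : X i * FreeMonoid.lift X α - Y i * FreeMonoid.lift Y α =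
        (X - Y) i * FreeMonoid.lift X α + Y i * (FreeMonoid.lift X α - FreeMonoid.lift Y α) := by
      rw [Pi.sub_apply]
      noncomm_ring
    have h2 : ‖(X - Y) i * FreeMonoid.lift X α‖ ≤ ‖X - Y‖ * 1 := (norm_mul_le _ _).trans
      (mul_le_mul (norm_le_pi_norm (X - Y) i) (norm_lift_le_one hX α) (norm_nonneg _)
        (norm_nonneg _))
    have h3 : ‖Y i * (FreeMonoid.lift X α - FreeMonoid.lift Y α)‖ ≤ 1 * (C * ‖X - Y‖) :=
      (norm_mul_le _ _).trans (mul_le_mul ((norm_apply_le_rowNorm Y i).trans hY) (hC X Y hX hY)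
        (norm_nonneg _) zero_le_one)
    rw [h1]
    refine (norm_add_le _ _).trans ((add_le_add h2 h3).trans_eq ?_)
    push_cast
    ring

theorem uniformContinuous_lift (α : FreeMonoid (Fin n)) :
    UniformContinuous fun X : OpenBall n K => FreeMonoid.lift X.1 α := by
  obtain ⟨C, hC⟩ := exists_norm_lift_sub_le (K := K) α
  refine (LipschitzWith.of_dist_le_mul (K := C) fun X Y => ?_).uniformContinuous
  rw [dist_eq_norm, Subtype.dist_eq, dist_eq_norm]
  exact hC X.1 Y.1 X.2.le Y.2.le

/-- The vectors `x` for which `T i x` depends uniformly continuously on `i`. -/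
def uniformSubmodule {ι V W : Type*} [UniformSpace ι] [NormedAddCommGroup V] [NormedSpace ℂ V]
    [NormedAddCommGroup W] [NormedSpace ℂ W] (T : ι → V →L[ℂ] W) : Submodule ℂ V where
  carrier := {x | UniformContinuous fun i => T i x}
  add_mem' {x y} hx hy := by
    have hx' : UniformContinuous fun i => T i x := hx
    have hy' : UniformContinuous fun i => T i y := hy
    simpa only [Set.mem_ofPred_eq, map_add] using hx'.add hy'
  zero_mem' := by simpa only [Set.mem_ofPred_eq, map_zero] using uniformContinuous_const
  smul_mem' c x hx := by
    have hx' : UniformContinuous fun i => T i x := hx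
    simp only [Set.mem_ofPred_eq, map_smul]
    exact hx'.const_smul c

theorem isClosed_uniformSubmodule {ι V W : Type*} [UniformSpace ι] [NormedAddCommGroup V]
    [NormedSpace ℂ V] [NormedAddCommGroup W] [NormedSpace ℂ W] {T : ι → V →L[ℂ] W}
    (hT : ∀ i x, ‖T i x‖ ≤ ‖x‖) : IsClosed (uniformSubmodule T : Set V) := by
  refine isClosed_of_closure_subset fun x hx =>
    (Metric.uniformity_basis_dist.tendsto_right_iff).2 fun ε hε => ?_
  obtain ⟨y, hy, hxy⟩ := Metric.mem_closure_iff.1 hx (ε / 3) (by positivity)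
  filter_upwards [(Metric.uniformity_basis_dist.tendsto_right_iff).1 hy (ε / 3)
    (by positivity)] with p hp
  have h1 : ∀ i, dist (T i x) (T i y) ≤ dist x y := fun i => by
    rw [dist_eq_norm, dist_eq_norm, ← map_sub]
    exact hT i _
  have h2 := dist_triangle4 (T p.1 x) (T p.1 y) (T p.2 y) (T p.2 x)
  have h3 := h1 p.2
  rw [dist_comm (T p.2 x)] at h3
  have h4 : dist (T p.1 y) (T p.2 y) < ε / 3 := hp
  change dist (T p.1 x) (T p.2 x) < ε
  linarith [h1 p.1]

theorem uniformContinuous_adjoint :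
    UniformContinuous fun T : K →L[ℂ] K => T.adjoint :=
  (ContinuousLinearMap.adjoint (𝕜 := ℂ) (E := K) (F := K)).isometry.uniformContinuous

theorem uniformContinuous_poissonTransform
    {f : HilbertTensor E (Fock n) →L[ℂ] HilbertTensor E (Fock n)} (hf : f ∈ boundarySpace n E) :
    UniformContinuous fun X : OpenBall n K => poissonTransform X.1 f := by
  have h1 : ∀ (Y : E →L[ℂ] E) (α : FreeMonoid (Fin n)),
      UniformContinuous fun X : OpenBall n K =>
        poissonTransform X.1 (opTensor Y (FreeMonoid.lift leftCreation α)) := fun Y α => by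
    have h : ∀ X : OpenBall n K, poissonTransform X.1
        (opTensor Y (FreeMonoid.lift leftCreation α)) =
        opTensorL K K Y (FreeMonoid.lift X.1 α) := fun X => poissonTransform_word X.2 Y α
    simp only [h]
    exact (opTensorL K K Y).uniformContinuous.comp (uniformContinuous_lift α)
  let M : Submodule ℂ (HilbertTensor E (Fock n) →L[ℂ] HilbertTensor E (Fock n)) :=
    uniformSubmodule (V := HilbertTensor E (Fock n) →L[ℂ] HilbertTensor E (Fock n))
      (W := HilbertTensor E K →L[ℂ] HilbertTensor E K) (fun X : OpenBall n K => poissonL E X.1)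
  have hM : ∀ g, g ∈ M ↔ UniformContinuous fun X : OpenBall n K => poissonTransform X.1 g :=
    fun g => by
      change (UniformContinuous fun X : OpenBall n K => poissonL E X.1 g) ↔ _
      simp only [poissonL_apply]
  rw [← hM]
  refine boundarySpace_le (M := M)
    (isClosed_uniformSubmodule fun X g => ?_) (fun Y α => (hM _).2 (h1 Y α))
    (fun Y α => (hM _).2 ?_) hf
  · rw [poissonL_apply]
    exact norm_poissonTransform_le X.2 g
  · simp only [poissonTransform_adjoint]
    exact uniformContinuous_adjoint.comp (h1 Y α)

/-- The inclusion of the open ball in the closed ball. -/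
def ballInclusion (n : ℕ) (K : Type*) [NormedAddCommGroup K] [InnerProductSpace ℂ K]
    [CompleteSpace K] (X : OpenBall n K) : ClosedBall n K := ⟨X.1, X.2.le⟩

theorem isUniformInducing_ballInclusion : IsUniformInducing (ballInclusion n K) :=
  (isUniformEmbedding_subtype_val (p := fun X : Fin n → K →L[ℂ] K => rowNorm X ≤ 1)
    |>.isUniformInducing.of_comp_iff).1
      (isUniformEmbedding_subtype_val.isUniformInducing)

theorem tendsto_dilate (X : Fin n → K →L[ℂ] K) (hX : rowNorm X ≤ 1) :
    Filter.Tendsto (fun r => ballInclusion n K (dilate r X hX)) radial (𝓝 ⟨X, hX⟩) := by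
  rw [tendsto_subtype_rng]
  have h := tendsto_ofReal_radial.smul_const X
  rwa [one_smul] at h

theorem denseRange_ballInclusion : DenseRange (ballInclusion n K) := fun X =>
  mem_closure_of_tendsto (b := radial) (tendsto_dilate X.1 X.2)
    (Filter.Eventually.of_forall fun _ => Set.mem_range_self _)

theorem hasContinuousExtension_of_poissonTransform {u : OpenBall n K → MinOp E K}
    {f : HilbertTensor E (Fock n) →L[ℂ] HilbertTensor E (Fock n)} (hf : f ∈ boundarySpace n E)
    (hu : ∀ X : OpenBall n K, (u X).1 = poissonTransform X.1 f) : HasContinuousExtension u := by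
  have h1 : UniformContinuous u := by
    refine isUniformEmbedding_subtype_val.isUniformInducing.uniformContinuous_iff.2 ?_
    have h2 : (Subtype.val ∘ u) = fun X : OpenBall n K => poissonTransform X.1 f := funext hu
    rw [h2]
    exact uniformContinuous_poissonTransform hf
  -- Completeness of the target is what permits extending by uniform continuity from the open ball,
  -- which is dense since `rX → X`.
  have hc : CompleteSpace (MinOp E K) :=
    (Submodule.isClosed_topologicalClosure _).completeSpace_coe
  refine ⟨_, (uniformContinuous_uniformly_extend isUniformInducing_ballInclusion
    denseRange_ballInclusion h1).continuous, fun X => ?_⟩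
  exact uniformly_extend_of_ind isUniformInducing_ballInclusion denseRange_ballInclusion h1 X

end Extension

/-! ### Compression to a copy of the Fock space -/

section Compression

variable {n : ℕ}

theorem exists_fock_isometry (n : ℕ) {H : Type*} [NormedAddCommGroup H] [InnerProductSpace ℂ H]
    [CompleteSpace H] (hH : ¬ FiniteDimensional ℂ H) : Nonempty (Fock n →ₗᵢ[ℂ] H) := by
  obtain ⟨w, b, -⟩ := exists_hilbertBasis ℂ H
  -- A finite Hilbert basis would have closed, hence full, span. Since the words are countable, the
  -- Fock basis can then be injected into the basis of `H`.
  have hw : Infinite w := by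
    by_contra hfin
    rw [not_infinite_iff_finite] at hfin
    refine hH ?_
    have hfd : FiniteDimensional ℂ (Submodule.span ℂ (Set.range b)) :=
      FiniteDimensional.span_of_finite ℂ (Set.finite_range b)
    have htop : Submodule.span ℂ (Set.range b) = ⊤ := by
      rw [← b.dense_span]
      exact (Submodule.closed_of_finiteDimensional _).submodule_topologicalClosure_eq.symm
    rw [htop] at hfd
    exact Module.Finite.equiv (Submodule.topEquiv (R := ℂ) (M := H))
  have hc : Countable (FreeMonoid (Fin n)) := inferInstanceAs (Countable (List (Fin n)))
  obtain ⟨g, hg⟩ := exists_injective_nat (FreeMonoid (Fin n))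
  exact ⟨(b.orthonormal.comp _
    ((Infinite.natEmbedding w).injective.comp hg)).orthogonalFamily.linearIsometry⟩

/-! ### Compressions of free pluriharmonic functions. -/

variable {E H K : Type*}
  [NormedAddCommGroup E] [InnerProductSpace ℂ E] [CompleteSpace E]
  [NormedAddCommGroup H] [InnerProductSpace ℂ H] [CompleteSpace H]
  [NormedAddCommGroup K] [InnerProductSpace ℂ K] [CompleteSpace K]

/-- The operator `I_E ⊗ V`. -/
def ampliation (E : Type*) [NormedAddCommGroup E] [InnerProductSpace ℂ E] (V : K →ₗᵢ[ℂ] H) :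
    HilbertTensor E K →L[ℂ] HilbertTensor E H :=
  opTensor (ContinuousLinearMap.id ℂ E) V.toContinuousLinearMap

theorem adjoint_comp_isometry (V : K →ₗᵢ[ℂ] H) :
    V.toContinuousLinearMap.adjoint ∘L V.toContinuousLinearMap = ContinuousLinearMap.id ℂ K :=
  (ContinuousLinearMap.norm_map_iff_adjoint_comp_self _).1 V.norm_map

omit [CompleteSpace E] [CompleteSpace H] [CompleteSpace K] in
theorem norm_ampliation_le (V : K →ₗᵢ[ℂ] H) : ‖ampliation E V‖ ≤ 1 :=
  (norm_opTensor_le _ _).trans (mul_le_one₀ ContinuousLinearMap.norm_id_le (norm_nonneg _)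
    V.norm_toContinuousLinearMap_le)

/-- The compression of an operator on `E ⊗ H` along `I_E ⊗ V`. -/
def compression (E : Type*) [NormedAddCommGroup E] [InnerProductSpace ℂ E] [CompleteSpace E]
    (V : K →ₗᵢ[ℂ] H) :
    (HilbertTensor E H →L[ℂ] HilbertTensor E H) →L[ℂ] (HilbertTensor E K →L[ℂ] HilbertTensor E K) :=
  sandwich (ampliation E V).adjoint (ampliation E V)

omit [CompleteSpace H] [CompleteSpace K] in
theorem compression_adjoint (V : K →ₗᵢ[ℂ] H) (T : HilbertTensor E H →L[ℂ] HilbertTensor E H) :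
    compression E V T.adjoint = (compression E V T).adjoint := by
  rw [compression, sandwich_apply, sandwich_apply, ContinuousLinearMap.adjoint_comp,
    ContinuousLinearMap.adjoint_comp, ContinuousLinearMap.adjoint_adjoint]
  rfl

omit [CompleteSpace H] [CompleteSpace K] in
theorem lift_comp_isometry {V : K →ₗᵢ[ℂ] H} {X : Fin n → H →L[ℂ] H} {T : Fin n → K →L[ℂ] K}
    (h : ∀ i, X i ∘L V.toContinuousLinearMap = V.toContinuousLinearMap ∘L T i)
    (α : FreeMonoid (Fin n)) :
    FreeMonoid.lift X α ∘L V.toContinuousLinearMap =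
      V.toContinuousLinearMap ∘L FreeMonoid.lift T α := by
  induction α using FreeMonoid.inductionOn' with
  | one => rw [map_one, map_one]; rfl
  | of_mul i α ih =>
    rw [map_mul, map_mul, FreeMonoid.lift_eval_of, FreeMonoid.lift_eval_of,
      ContinuousLinearMap.mul_def, ContinuousLinearMap.mul_def, ContinuousLinearMap.comp_assoc, ih,
      ← ContinuousLinearMap.comp_assoc, h, ContinuousLinearMap.comp_assoc]

/-- The range of `V` is invariant under the `X_i`, so `V* X_α V = V* V T_α = T_α` for every word. -/
theorem compression_powerSum {V : K →ₗᵢ[ℂ] H} {X : Fin n → H →L[ℂ] H} {T : Fin n → K →L[ℂ] K}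
    (h : ∀ i, X i ∘L V.toContinuousLinearMap = V.toContinuousLinearMap ∘L T i)
    {A : FreeMonoid (Fin n) → E →L[ℂ] E} (hA : 1 ≤ radiusOfConvergence A) (hX : rowNorm X < 1) :
    compression E V (powerSum A X) = powerSum A T := by
  have h1 := (compression E V).hasSum (hasSum_powerSum hA hX)
  refine (HasSum.tsum_eq ?_).symm
  convert h1 using 1
  funext k
  rw [homogeneousPart, homogeneousPart, map_sum]
  refine Finset.sum_congr rfl fun w _ => ?_
  rw [compression, sandwich_apply, ampliation, adjoint_opTensor, ← opTensor_comp, ← opTensor_comp,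
    lift_comp_isometry h, ← ContinuousLinearMap.comp_assoc _ _ (FreeMonoid.lift T (word w)),
    adjoint_comp_isometry, ContinuousLinearMap.adjoint_id]
  rfl

theorem IsFreePluriharmonicWith.compression_eq {A B : FreeMonoid (Fin n) → E →L[ℂ] E}
    {u : OpenBall n H → MinOp E H} {v : OpenBall n K → MinOp E K}
    (hu : IsFreePluriharmonicWith A B u) (hv : IsFreePluriharmonicWith A B v) {V : K →ₗᵢ[ℂ] H}
    {X : OpenBall n H} {T : OpenBall n K}
    (h : ∀ i, X.1 i ∘L V.toContinuousLinearMap = V.toContinuousLinearMap ∘L T.1 i) :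
    compression E V (u X).1 = (v T).1 := by
  have hs := fun c : ℂ => one_le_radiusOfConvergence_smul c hu.radius.1
  have ht := fun c : ℂ => one_le_radiusOfConvergence_smul c hu.radius.2
  rw [hu.eq_powerSum, hv.eq_powerSum, map_add, compression_adjoint,
    compression_powerSum h (one_le_radiusOfConvergence_add (hs _) (ht _)) X.2,
    compression_powerSum h (one_le_radiusOfConvergence_add (hs _) (ht _)) X.2]

/-- The creation operators, transported to `H` by an isometry `V`. -/
def transportedCreation (V : Fock n →ₗᵢ[ℂ] H) (i : Fin n) : H →L[ℂ] H :=
  V.toContinuousLinearMap ∘L leftCreation i ∘L V.toContinuousLinearMap.adjoint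

theorem rowNorm_transportedCreation_le (V : Fock n →ₗᵢ[ℂ] H) :
    rowNorm (transportedCreation V) ≤ 1 := by
  refine Real.sqrt_le_one.2 ?_
  have h := norm_sum_adjoint_comp_le (fun i => (transportedCreation V i).adjoint) zero_le_one
    fun y => ?_
  · simpa only [ContinuousLinearMap.adjoint_adjoint] using h
  have h1 : ∀ i, ‖(transportedCreation V i).adjoint y‖ =
      ‖(leftCreation i).adjoint (V.toContinuousLinearMap.adjoint y)‖ := fun i => by
    rw [transportedCreation, ContinuousLinearMap.adjoint_comp, ContinuousLinearMap.adjoint_comp,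
      ContinuousLinearMap.adjoint_adjoint]
    exact V.norm_map _
  simp only [h1]
  have hV : ‖V.toContinuousLinearMap.adjoint‖ ≤ 1 :=
    (LinearIsometryEquiv.norm_map ContinuousLinearMap.adjoint V.toContinuousLinearMap).trans_le
      V.norm_toContinuousLinearMap_le
  have h2 := V.toContinuousLinearMap.adjoint.le_of_opNorm_le hV y
  rw [one_mul] at h2
  refine (sum_norm_adjoint_sq_le _ _).trans ?_
  exact mul_le_mul (pow_le_one₀ (rowNorm_nonneg _) rowNorm_leftCreation_le)
    (pow_le_pow_left₀ (norm_nonneg _) h2 2) (by positivity) zero_le_one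

/-- The values at `rS` of any Fock representation of `u` are compressions of values of `u`. -/
theorem IsFockRepresentation.apply_scaledCreation {u : OpenBall n H → MinOp E H}
    {v : OpenBall n (Fock n) → MinOp E (Fock n)} (h : IsFockRepresentation u v)
    (V : Fock n →ₗᵢ[ℂ] H) (r : Set.Ico (0 : ℝ) 1) :
    (v (scaledCreation n r)).1 =
      compression E V (u (dilate r (transportedCreation V) (rowNorm_transportedCreation_le V))).1 := by
  obtain ⟨A, B, hu, hv⟩ := h
  refine (hu.compression_eq hv fun i => ?_).symm
  change (((r : ℝ) : ℂ) • transportedCreation V i) ∘L _ = _ ∘L (((r : ℝ) : ℂ) • leftCreation i)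
  rw [ContinuousLinearMap.smul_comp, ContinuousLinearMap.comp_smul, transportedCreation,
    ContinuousLinearMap.comp_assoc, ContinuousLinearMap.comp_assoc, adjoint_comp_isometry]
  rfl

/-- The transported tuple `T = V S V*` is in the closed ball and `rT → T`, so the limit is the
compression of the extension evaluated at `T`. -/
theorem exists_radialLimit_of_hasContinuousExtension (hH : ¬ FiniteDimensional ℂ H)
    {u : OpenBall n H → MinOp E H} (hu : IsFreePluriharmonic u) (hc : HasContinuousExtension u) :
    ∃ v, IsFockRepresentation u v ∧ ∃ g, RadialLimit v g := by
  obtain ⟨V⟩ := exists_fock_isometry n hH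
  obtain ⟨A, B, hAB⟩ := hu
  obtain ⟨v, hv⟩ := exists_isFreePluriharmonicWith (K := Fock n) hAB.radius.1 hAB.radius.2
  have hrep : IsFockRepresentation u v := ⟨A, B, hAB, hv⟩
  obtain ⟨w, hw, hwu⟩ := hc
  refine ⟨v, hrep, compression E V (w ⟨_, rowNorm_transportedCreation_le V⟩).1, ?_⟩
  have h1 := ((compression E V).continuous.comp (continuous_subtype_val.comp hw)).tendsto
    ⟨_, rowNorm_transportedCreation_le V⟩
  refine (h1.comp (tendsto_dilate _ (rowNorm_transportedCreation_le V))).congr fun r => ?_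
  rw [hrep.apply_scaledCreation V, ← hwu]
  rfl

/-- Values at `rS` are compressions of values of `u`, hence the same for all Fock representations;
uniqueness of coefficients is not needed. -/
theorem radialLimit_of_poissonTransform (hH : ¬ FiniteDimensional ℂ H)
    {u : OpenBall n H → MinOp E H}
    {f : HilbertTensor E (Fock n) →L[ℂ] HilbertTensor E (Fock n)} (hf : f ∈ boundarySpace n E)
    (hu : ∀ X : OpenBall n H, (u X).1 = poissonTransform X.1 f)
    {v : OpenBall n (Fock n) → MinOp E (Fock n)} (hv : IsFockRepresentation u v) :
    RadialLimit v f := by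
  obtain ⟨V⟩ := exists_fock_isometry n hH
  obtain ⟨v', hv', hlim⟩ := exists_isFockRepresentation hf hu
  refine Filter.Tendsto.congr (fun r => ?_) hlim
  rw [hv.apply_scaledCreation V, hv'.apply_scaledCreation V]

end Compression

/-! ### Matrices of operators -/

section Matrices

variable {m : ℕ} {K L : Type*}
  [NormedAddCommGroup K] [InnerProductSpace ℂ K] [CompleteSpace K]
  [NormedAddCommGroup L] [InnerProductSpace ℂ L] [CompleteSpace L]

omit [CompleteSpace K] in
theorem sum_norm_sq_le_norm_matrixOp (T : Fin m → Fin m → K →L[ℂ] K) (y : Fin m → K) :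
    ∑ i, ‖∑ j, T i j (y j)‖ ^ 2 ≤ ‖matrixOp T‖ ^ 2 * ∑ j, ‖y j‖ ^ 2 := by
  have h := pow_le_pow_left₀ (norm_nonneg _) ((matrixOp T).le_opNorm (WithLp.toLp 2 y)) 2
  rw [mul_pow, PiLp.norm_sq_eq_of_L2, PiLp.norm_sq_eq_of_L2] at h
  simpa only [matrixOp_apply] using h

omit [CompleteSpace K] in
theorem norm_matrixOp_le {T : Fin m → Fin m → K →L[ℂ] K} {c : ℝ} (hc : 0 ≤ c)
    (h : ∀ y : Fin m → K, ∑ i, ‖∑ j, T i j (y j)‖ ^ 2 ≤ c ^ 2 * ∑ j, ‖y j‖ ^ 2) :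
    ‖matrixOp T‖ ≤ c := by
  refine ContinuousLinearMap.opNorm_le_bound _ hc fun x => ?_
  refine (sq_le_sq₀ (norm_nonneg _) (by positivity)).1 ?_
  rw [mul_pow, PiLp.norm_sq_eq_of_L2, PiLp.norm_sq_eq_of_L2]
  simpa only [matrixOp_apply] using h x

omit [CompleteSpace K] [CompleteSpace L] in
theorem norm_matrixOp_sandwich_le {B : K →L[ℂ] L} {A : L →L[ℂ] K} (hB : ‖B‖ ≤ 1) (hA : ‖A‖ ≤ 1)
    (T : Fin m → Fin m → K →L[ℂ] K) :
    ‖matrixOp fun i j => sandwich B A (T i j)‖ ≤ ‖matrixOp T‖ := by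
  refine norm_matrixOp_le (ContinuousLinearMap.opNorm_nonneg _) fun y => ?_
  have h1 : ∀ i, ‖∑ j, sandwich B A (T i j) (y j)‖ ^ 2 ≤ ‖∑ j, T i j (A (y j))‖ ^ 2 := fun i => by
    have h2 : ∑ j, sandwich B A (T i j) (y j) = B (∑ j, T i j (A (y j))) := by
      rw [map_sum]
      rfl
    have h3 := B.le_of_opNorm_le hB (∑ j, T i j (A (y j)))
    rw [one_mul] at h3
    rw [h2]
    exact pow_le_pow_left₀ (norm_nonneg _) h3 2
  refine (Finset.sum_le_sum fun i _ => h1 i).trans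
    ((sum_norm_sq_le_norm_matrixOp T fun j => A (y j)).trans ?_)
  refine mul_le_mul_of_nonneg_left (Finset.sum_le_sum fun j _ => ?_) (by positivity)
  have h3 := A.le_of_opNorm_le hA (y j)
  rw [one_mul] at h3
  exact pow_le_pow_left₀ (norm_nonneg _) h3 2

/-- The `i`-th coordinate projection of `K^{(m)}`. -/
abbrev coordProj (K : Type*) [NormedAddCommGroup K] [InnerProductSpace ℂ K] (i : Fin m) :
    PiLp 2 (fun _ : Fin m => K) →L[ℂ] K :=
  PiLp.proj 2 (fun _ : Fin m => K) i

theorem adjoint_coordProj_apply (j k : Fin m) (x : K) :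
    ((coordProj K j).adjoint x) k = if k = j then x else 0 := by
  have h : (coordProj K j).adjoint x = WithLp.toLp 2 (fun k => if k = j then x else 0) := by
    refine ext_inner_left ℂ fun z => ?_
    rw [ContinuousLinearMap.adjoint_inner_right, PiLp.inner_apply, Finset.sum_eq_single j]
    · simp
    · intro i _ hi
      simp [hi]
    · simp
  rw [h]

theorem coordProj_comp_matrixOp (T : Fin m → Fin m → K →L[ℂ] K) (i j : Fin m) :
    coordProj K i ∘L matrixOp T ∘L (coordProj K j).adjoint = T i j := by
  ext1 x
  change matrixOp T ((coordProj K j).adjoint x) i = T i j x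
  rw [matrixOp_apply, Finset.sum_eq_single j]
  · rw [adjoint_coordProj_apply, if_pos rfl]
  · intro k _ hk
    rw [adjoint_coordProj_apply, if_neg hk, map_zero]
  · simp

theorem sum_norm_sq_coordProj_opTensor_le
    (η : HilbertTensor (PiLp 2 (fun _ : Fin m => K)) L) :
    ∑ i, ‖opTensor (coordProj K i) (ContinuousLinearMap.id ℂ L) η‖ ^ 2 ≤ ‖η‖ ^ 2 := by
  have h1 : ‖∑ i, (coordProj (m := m) K i).adjoint ∘L coordProj K i‖ ≤ 1 :=
    norm_sum_adjoint_comp_le _ zero_le_one fun x => by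
      rw [one_mul, PiLp.norm_sq_eq_of_L2]
      rfl
  have h2 : ∑ i, (opTensor (coordProj (m := m) K i) (ContinuousLinearMap.id ℂ L)).adjoint ∘L
      opTensor (coordProj K i) (ContinuousLinearMap.id ℂ L) =
      opTensor (∑ i, (coordProj (m := m) K i).adjoint ∘L coordProj K i)
        (ContinuousLinearMap.id ℂ L) := by
    rw [← opTensorR_apply, map_sum]
    refine Finset.sum_congr rfl fun i _ => ?_
    rw [adjoint_opTensor, ← opTensor_comp, opTensorR_apply, ContinuousLinearMap.adjoint_id]
    rfl
  refine (sum_norm_sq_le (fun i => opTensor (coordProj K i) (ContinuousLinearMap.id ℂ L)) η).trans ?_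
  refine mul_le_of_le_one_left (by positivity) ?_
  rw [h2]
  exact (norm_opTensor_le _ _).trans
    (mul_le_one₀ h1 (norm_nonneg _) ContinuousLinearMap.norm_id_le)

/-- The matrix `[T_ij ⊗ I]` acts as `matrixOp T ⊗ I` on `K^{(m)} ⊗ L`. In place of a unitary
identification, the contractive column of the `p i` and its adjoint suffice. -/
theorem norm_matrixOp_opTensor_id_le (T : Fin m → Fin m → K →L[ℂ] K) :
    ‖matrixOp fun i j => opTensor (T i j) (ContinuousLinearMap.id ℂ L)‖ ≤ ‖matrixOp T‖ := by
  refine norm_matrixOp_le (ContinuousLinearMap.opNorm_nonneg _) fun y => ?_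
  set p : Fin m → HilbertTensor (PiLp 2 (fun _ : Fin m => K)) L →L[ℂ] HilbertTensor K L :=
    fun i => opTensor (coordProj K i) (ContinuousLinearMap.id ℂ L) with hp
  set ξ := ∑ j, (p j).adjoint (y j) with hξ
  have hpξ := sum_norm_sq_coordProj_opTensor_le ξ
  -- `‖ξ‖² = ∑ Re ⟨y_j, p_j ξ⟩` is at most half of `∑ ‖y_j‖² + ∑ ‖p_j ξ‖²`, and the last sum is at
  -- most `‖ξ‖²`.
  have h1 : ‖ξ‖ ^ 2 ≤ ∑ j, ‖y j‖ ^ 2 := by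
    have h2 : ‖ξ‖ ^ 2 = ∑ j, RCLike.re (inner ℂ (y j) (p j ξ) : ℂ) := by
      rw [← inner_self_eq_norm_sq (𝕜 := ℂ)]
      nth_rewrite 1 [hξ]
      rw [sum_inner, map_sum]
      simp only [ContinuousLinearMap.adjoint_inner_left]
    have h3 : ∀ j, RCLike.re (inner ℂ (y j) (p j ξ) : ℂ) ≤ (‖y j‖ ^ 2 + ‖p j ξ‖ ^ 2) / 2 :=
      fun j => by
        have h4 : RCLike.re (inner ℂ (y j) (p j ξ) : ℂ) ≤ ‖y j‖ * ‖p j ξ‖ :=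
          re_inner_le_norm (y j) (p j ξ)
        nlinarith [sq_nonneg (‖y j‖ - ‖p j ξ‖)]
    have h4 := Finset.sum_le_sum fun j (_ : j ∈ Finset.univ) => h3 j
    rw [← h2, ← Finset.sum_div, Finset.sum_add_distrib] at h4
    linarith
  have h5 : ∀ i, ∑ j, opTensor (T i j) (ContinuousLinearMap.id ℂ L) (y j) =
      p i (opTensor (matrixOp T) (ContinuousLinearMap.id ℂ L) ξ) := fun i => by
    rw [hξ, map_sum, map_sum]
    refine Finset.sum_congr rfl fun j _ => ?_
    rw [hp, adjoint_opTensor, ← ContinuousLinearMap.comp_apply, ← ContinuousLinearMap.comp_apply,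
      ← opTensor_comp, ← opTensor_comp, ContinuousLinearMap.adjoint_id,
      ContinuousLinearMap.comp_assoc, coordProj_comp_matrixOp]
    rfl
  simp only [h5]
  refine (sum_norm_sq_coordProj_opTensor_le _).trans ?_
  have h6 := (opTensor (matrixOp T) (ContinuousLinearMap.id ℂ L)).le_of_opNorm_le
    ((norm_opTensor_le _ _).trans
      (mul_le_of_le_one_right (norm_nonneg _) ContinuousLinearMap.norm_id_le)) ξ
  refine (pow_le_pow_left₀ (norm_nonneg _) h6 2).trans ?_
  rw [mul_pow]
  exact mul_le_mul_of_nonneg_left h1 (by positivity)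

/-! ### Matrix norms of Poisson transforms. -/

variable {n : ℕ} {E H : Type*}
  [NormedAddCommGroup E] [InnerProductSpace ℂ E] [CompleteSpace E]
  [NormedAddCommGroup H] [InnerProductSpace ℂ H] [CompleteSpace H]

/-- The Poisson transform is completely contractive. -/
theorem norm_matrixOp_poissonTransform_le {X : Fin n → H →L[ℂ] H} (hX : rowNorm X < 1)
    (f : Fin m → Fin m → HilbertTensor E (Fock n) →L[ℂ] HilbertTensor E (Fock n)) :
    ‖matrixOp fun i j => poissonTransform X (f i j)‖ ≤ ‖matrixOp f‖ := by
  have hA := norm_kernelEmbedding_le (E := E) hX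
  have hB : ‖(kernelEmbedding E X).adjoint‖ ≤ 1 :=
    (LinearIsometryEquiv.norm_map ContinuousLinearMap.adjoint (kernelEmbedding E X)).trans_le hA
  have h : (fun i j => poissonTransform X (f i j)) = fun i j =>
      sandwich (kernelEmbedding E X).adjoint (kernelEmbedding E X)
        (opTensor (f i j) (ContinuousLinearMap.id ℂ H)) := by
    funext i j
    rw [poissonTransform_eq, sandwich_apply]
  rw [h]
  exact (norm_matrixOp_sandwich_le hB hA _).trans (norm_matrixOp_opTensor_id_le f)

omit [CompleteSpace L] [CompleteSpace H] in
theorem norm_matrixOp_compression_le (V : L →ₗᵢ[ℂ] H)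
    (T : Fin m → Fin m → HilbertTensor E H →L[ℂ] HilbertTensor E H) :
    ‖matrixOp fun i j => compression E V (T i j)‖ ≤ ‖matrixOp T‖ :=
  norm_matrixOp_sandwich_le
    ((LinearIsometryEquiv.norm_map ContinuousLinearMap.adjoint (ampliation E V)).trans_le
      (norm_ampliation_le V)) (norm_ampliation_le V) T

omit [CompleteSpace K] in
theorem norm_matrixOp_le_of_tendsto {ι : Type*} {l : Filter ι} [l.NeBot]
    {T : ι → Fin m → Fin m → K →L[ℂ] K} {S : Fin m → Fin m → K →L[ℂ] K} {c : ℝ} (hc : 0 ≤ c)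
    (hT : ∀ i j, Filter.Tendsto (fun r => T r i j) l (𝓝 (S i j)))
    (h : ∀ r, ‖matrixOp (T r)‖ ≤ c) : ‖matrixOp S‖ ≤ c := by
  refine norm_matrixOp_le hc fun y => ?_
  have hlim : Filter.Tendsto (fun r => ∑ i, ‖∑ j, T r i j (y j)‖ ^ 2) l
      (𝓝 (∑ i, ‖∑ j, S i j (y j)‖ ^ 2)) := by
    refine tendsto_finsetSum _ fun i _ => (Filter.Tendsto.norm ?_).pow 2
    refine tendsto_finsetSum _ fun j _ => ?_
    exact ((ContinuousLinearMap.apply ℂ K (y j)).continuous.tendsto _).comp (hT i j)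
  refine le_of_tendsto hlim (Filter.Eventually.of_forall fun r => ?_)
  refine (sum_norm_sq_le_norm_matrixOp (T r) y).trans ?_
  exact mul_le_mul_of_nonneg_right (pow_le_pow_left₀ (ContinuousLinearMap.opNorm_nonneg _) (h r) 2)
    (Finset.sum_nonneg fun _ _ => by positivity)

theorem isLUB_norm_matrixOp_poissonTransform (hH : ¬ FiniteDimensional ℂ H)
    {f : Fin m → Fin m → HilbertTensor E (Fock n) →L[ℂ] HilbertTensor E (Fock n)}
    (hf : ∀ i j, f i j ∈ boundarySpace n E) :
    IsLUB (Set.range fun X : OpenBall n H => ‖matrixOp fun i j => poissonTransform X.1 (f i j)‖)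
      ‖matrixOp f‖ := by
  refine ⟨?_, fun c hc => ?_⟩
  · rintro _ ⟨X, rfl⟩
    exact norm_matrixOp_poissonTransform_le X.2 f
  · obtain ⟨V⟩ := exists_fock_isometry n hH
    have hc' : ∀ X : OpenBall n H, ‖matrixOp fun i j => poissonTransform X.1 (f i j)‖ ≤ c :=
      fun X => hc ⟨X, rfl⟩
    set X := fun r => dilate r (transportedCreation V) (rowNorm_transportedCreation_le V)
    -- The ball is nonempty, as the point with `r = 0` shows, so an upper bound of norms is
    -- nonnegative.
    have hc0 : 0 ≤ c := (ContinuousLinearMap.opNorm_nonneg _).trans (hc' (X ⟨0, le_rfl, one_pos⟩))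
    refine norm_matrixOp_le_of_tendsto (l := radial)
      (T := fun r i j => compression E V (poissonTransform (X r).1 (f i j))) hc0 (fun i j => ?_)
      fun r => (norm_matrixOp_compression_le V _).trans (hc' (X r))
    obtain ⟨v, hv, hlim⟩ :=
      exists_isFockRepresentation (u := poissonFun H (hf i j)) (hf i j) fun _ => rfl
    exact Filter.Tendsto.congr (fun r => hv.apply_scaledCreation V r) hlim

end Matrices

/-! ### The Poisson transform as a linear map -/

section LinearMap

variable {n : ℕ} {E H : Type*}
  [NormedAddCommGroup E] [InnerProductSpace ℂ E] [CompleteSpace E]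
  [NormedAddCommGroup H] [InnerProductSpace ℂ H] [CompleteSpace H]

variable (n E H) in
/-- The Poisson transform, from boundary functions to functions on the open ball. -/
def poissonMap : boundarySpace n E →ₗ[ℂ] (OpenBall n H → MinOp E H) where
  toFun f := poissonFun H f.2
  map_add' f g := by
    funext X
    refine Subtype.ext ?_
    change poissonTransform X.1 (f.1 + g.1) = poissonTransform X.1 f.1 + poissonTransform X.1 g.1
    rw [← poissonL_apply, map_add, poissonL_apply, poissonL_apply]
  map_smul' c f := by
    funext X
    refine Subtype.ext ?_
    change poissonTransform X.1 (c • f.1) = c • poissonTransform X.1 f.1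
    rw [← poissonL_apply, map_smul, poissonL_apply]

theorem poissonMap_apply (f : boundarySpace n E) (X : OpenBall n H) :
    (poissonMap n E H f X).1 = poissonTransform X.1 f.1 := rfl

/-- If `f` and `g` have the same transform, both are the radial limit of one Fock representation. -/
theorem poissonMap_injective (hH : ¬ FiniteDimensional ℂ H) :
    Function.Injective (poissonMap n E H) := by
  intro f g hfg
  obtain ⟨v, hv, hlim⟩ := exists_isFockRepresentation (u := poissonMap n E H f) f.2 fun _ => rfl
  have h : ∀ X, (poissonMap n E H f X).1 = poissonTransform X.1 g.1 := fun X => by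
    rw [hfg, poissonMap_apply]
  exact Subtype.ext (tendsto_nhds_unique (l := radial) hlim
    (radialLimit_of_poissonTransform hH g.2 h hv))

theorem boundary_tfae (hH : ¬ FiniteDimensional ℂ H) (u : OpenBall n H → MinOp E H) :
    List.TFAE [
      IsFreePluriharmonic u ∧ HasContinuousExtension u,
      ∃ f ∈ boundarySpace n E, ∀ X : OpenBall n H,
        (u X : HilbertTensor E H →L[ℂ] HilbertTensor E H) = poissonTransform X.1 f,
      IsFreePluriharmonic u ∧ ∃ v, IsFockRepresentation u v ∧ ∃ g, RadialLimit v g] := by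
  tfae_have 1 → 3 := fun ⟨h1, h2⟩ => ⟨h1, exists_radialLimit_of_hasContinuousExtension hH h1 h2⟩
  tfae_have 3 → 2 := fun ⟨_, _, hv, g, hg⟩ => ⟨g, poissonTransform_of_radialLimit hv hg⟩
  tfae_have 2 → 1 := fun ⟨_, hf, hu⟩ =>
    ⟨⟨_, _, isFreePluriharmonicWith_poissonTransform hf hu⟩,
      hasContinuousExtension_of_poissonTransform hf hu⟩
  tfae_finish

end LinearMap

end FreePluri

end

/-! ### The main theorem. -/

open FreePluri in
theorem theorem4p1 (n : ℕ) (hn : 1 ≤ n) (E H : Type*)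
    [NormedAddCommGroup E] [InnerProductSpace ℂ E] [CompleteSpace E]
    [NormedAddCommGroup H] [InnerProductSpace ℂ H] [CompleteSpace H]
    (hH : ¬ FiniteDimensional ℂ H) :
    (∀ u : OpenBall n H → MinOp E H,
      List.TFAE [
        IsFreePluriharmonic u ∧ HasContinuousExtension u,
        ∃ f ∈ boundarySpace n E, ∀ X : OpenBall n H,
          (u X : HilbertTensor E H →L[ℂ] HilbertTensor E H) = poissonTransform X.1 f,
        IsFreePluriharmonic u ∧ ∃ v, IsFockRepresentation u v ∧ ∃ g, RadialLimit v g] ∧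
      ∀ f ∈ boundarySpace n E,
        (∀ X : OpenBall n H,
          (u X : HilbertTensor E H →L[ℂ] HilbertTensor E H) = poissonTransform X.1 f) →
        ∀ v, IsFockRepresentation u v → RadialLimit v f) ∧
    ∃ Har : Submodule ℂ (OpenBall n H → MinOp E H),
      (∀ u, u ∈ Har ↔ IsFreePluriharmonic u ∧ HasContinuousExtension u) ∧
      ∃ Φ : Har ≃ₗ[ℂ] boundarySpace n E,
        (∀ (u : Har) (X : OpenBall n H),
          (u.1 X : HilbertTensor E H →L[ℂ] HilbertTensor E H) =
            poissonTransform X.1 (Φ u).1) ∧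
        ∀ (m : ℕ) (U : Fin m → Fin m → Har),
          IsLUB (Set.range fun X : OpenBall n H => ‖matrixOp fun i j => ((U i j).1 X).1‖)
            ‖matrixOp fun i j => (Φ (U i j)).1‖ := by
  -- `Har` is taken to be the range of the Poisson map, which makes it a linear space at once, and
  -- `Φ` is the inverse of that map; membership is then the equivalence of (ii) and (i), entries 1
  -- and 0 of the list.
  refine ⟨fun u => ⟨boundary_tfae hH u, fun f hf hu v hv =>
    radialLimit_of_poissonTransform hH hf hu hv⟩, LinearMap.range (poissonMap n E H), fun u => ?_,
    (LinearEquiv.ofInjective (poissonMap n E H) (poissonMap_injective hH)).symm, ?_, ?_⟩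
  · refine Iff.trans ?_ ((boundary_tfae hH u).out 1 0)
    constructor
    · rintro ⟨f, rfl⟩
      exact ⟨f.1, f.2, fun X => rfl⟩
    · rintro ⟨f, hf, hu⟩
      exact ⟨⟨f, hf⟩, funext fun X => Subtype.ext (hu X).symm⟩
  · intro u X
    rw [← poissonMap_apply]
    exact congrArg (fun w : LinearMap.range (poissonMap n E H) => (w.1 X).1)
      ((LinearEquiv.ofInjective (poissonMap n E H) (poissonMap_injective hH)).apply_symm_apply u).symm
  · intro m U
    have h := isLUB_norm_matrixOp_poissonTransform hH fun i j =>
      ((LinearEquiv.ofInjective (poissonMap n E H) (poissonMap_injective hH)).symm (U i j)).2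
    have hU : ∀ i j (X : OpenBall n H), ((U i j).1 X).1 = poissonTransform X.1
        ((LinearEquiv.ofInjective (poissonMap n E H)
          (poissonMap_injective hH)).symm (U i j)).1 := fun i j X => by
      rw [← poissonMap_apply]
      exact congrArg (fun w : LinearMap.range (poissonMap n E H) => (w.1 X).1)
        ((LinearEquiv.ofInjective (poissonMap n E H)
          (poissonMap_injective hH)).apply_symm_apply (U i j)).symm
    simpa only [hU] using h
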